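/- Let $n \ge 1$. The Yangian $Y_n = Y(\mathfrak{gl}_n)$ is the unital associative $\mathbb{C}$-algebra generated by elements $T_{i,j}^{(r)}$ ($1 \le i,j \le n$, $r \ge 1$) subject to the relations $$(u-v)\,[T_{i,j}(u), T_{h,k}(v)] = T_{h,j}(u)\,T_{i,k}(v) - T_{h,j}(v)\,T_{i,k}(u) \qquad (1 \le h,i,j,k \le n),$$ where $T_{i,j}(u) = \sum_{r \ge 0} T_{i,j}^{(r)} u^{-r} \in Y_n[[u^{-1}]]$ and $T_{i,j}^{(0)} = \delta_{i,j}$. The matrix $T(u) = (T_{i,j}(u))_{1 \le i,j \le n}$ has a unique Gauss factorization $T(u) = F(u)\,D(u)\,E(u)$ over $Y_n[[u^{-1}]]$ with $F(u)$ lower unitriangular, $D(u) = \mathrm{diag}(D_1(u), \dots, D_n(u))$ diagonal and $E(u)$ upper unitriangular. Write $D_i(u) = \sum_{r \ge 0} D_i^{(r)} u^{-r}$, and let the Cartan subalgebra $Y_{(1^n)}$ be the unital subalgebra of $Y_n$ generated by all $D_i^{(r)}$ ($1 \le i \le n$, $r \ge 0$). Then $Y_{(1^n)}$ is a maximal commutative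 subalgebra of $Y_n$: it is commutative, and every commutative subalgebra of $Y_n$ containing it is equal to it. -/

import Mathlib

/-- `T = F D E`, where `F` is lower unitriangular, `D` is diagonal (with diagonal entries `d i`)
and `E` is upper unitriangular. The entries lie in a ring that need not be commutative. -/
structure IsGaussFactorization {R : Type*} [Ring R] {n : ℕ} (T F : Matrix (Fin n) (Fin n) R)
    (d : Fin n → R) (E : Matrix (Fin n) (Fin n) R) : Prop where
  lower_diag : ∀ i, F i i = 1
  lower_zero : ∀ i j, i < j → F i j = 0
  upper_diag : ∀ i, E i i = 1
  upper_zero : ∀ i j, j < i → E i j = 0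
  mul_eq : F * Matrix.diagonal d * E = T

theorem isGaussFactorization_apply {R : Type*} [Ring R] {n : ℕ} {T F : Matrix (Fin n) (Fin n) R}
    {d : Fin n → R} {E : Matrix (Fin n) (Fin n) R} (h : IsGaussFactorization T F d E)
    (i j : Fin n) : ∑ k, F i k * d k * E k j = T i j := by
  rw [← h.mul_eq, Matrix.mul_apply]
  simp only [Matrix.mul_diagonal]

/-- Existence of the Gauss factorization of a matrix of power series whose constant term is the
identity matrix. -/
theorem exists_isGaussFactorization {A : Type*} [Ring A] (n : ℕ) :
    ∀ T : Matrix (Fin n) (Fin n) (PowerSeries A),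
      (∀ i j, PowerSeries.constantCoeff (T i j) = if i = j then 1 else 0) →
      ∃ F d E, IsGaussFactorization T F d E := by
  induction n with
  | zero =>
    intro T _
    exact ⟨0, 0, 0, fun i => i.elim0, fun i => i.elim0, fun i => i.elim0, fun i => i.elim0,
      by ext i; exact i.elim0⟩
  | succ n ih =>
    intro T hT
    obtain ⟨u, hu⟩ : IsUnit (T 0 0) := by
      rw [PowerSeries.isUnit_iff_constantCoeff, hT]; simp
    obtain ⟨F, d, E, h⟩ := ih
      (Matrix.of fun i j => T i.succ j.succ - T i.succ 0 * (↑u⁻¹ : PowerSeries A) * T 0 j.succ)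
      (by intro i j; simp [hT])
    have hm := isGaussFactorization_apply h
    simp only [mul_assoc, Matrix.of_apply] at hm
    refine ⟨Matrix.of fun i j => Fin.cases (motive := fun _ => PowerSeries A)
        (Fin.cases (motive := fun _ => PowerSeries A) 1 (fun _ => 0) j)
        (fun i' => Fin.cases (motive := fun _ => PowerSeries A)
          (T i'.succ 0 * (↑u⁻¹ : PowerSeries A)) (fun j' => F i' j') j) i,
      Fin.cases (T 0 0) d,
      Matrix.of fun i j => Fin.cases (motive := fun _ => PowerSeries A)
        (Fin.cases (motive := fun _ => PowerSeries A) 1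
          (fun j' => (↑u⁻¹ : PowerSeries A) * T 0 j'.succ) j)
        (fun i' => Fin.cases (motive := fun _ => PowerSeries A) 0 (fun j' => E i' j') j) i,
      ?_, ?_, ?_, ?_, ?_⟩
    · intro i
      cases i using Fin.cases <;> simp [h.lower_diag]
    · intro i j hij
      cases i using Fin.cases <;> cases j using Fin.cases <;>
        simp_all [h.lower_zero]
    · intro i
      cases i using Fin.cases <;> simp [h.upper_diag]
    · intro i j hij
      cases i using Fin.cases <;> cases j using Fin.cases <;>
        simp_all [h.upper_zero]
    · ext1 i j
      simp only [Matrix.mul_apply (M := _ * _), Matrix.mul_diagonal, Fin.sum_univ_succ]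
      cases i using Fin.cases <;> cases j using Fin.cases <;>
        simp [hm, ← hu, mul_assoc]

/-- Uniqueness of the Gauss factorization of a matrix of power series whose constant term is the
identity matrix. -/
theorem isGaussFactorization_unique {A : Type*} [Ring A] (n : ℕ) :
    ∀ (T : Matrix (Fin n) (Fin n) (PowerSeries A))
      (_ : ∀ i j, PowerSeries.constantCoeff (T i j) = if i = j then 1 else 0)
      {F d E F' d' E'}, IsGaussFactorization T F d E → IsGaussFactorization T F' d' E' →
      F = F' ∧ d = d' ∧ E = E' := by
  induction n with
  | zero =>
    intros
    exact ⟨by ext i; exact i.elim0, by ext i; exact i.elim0, by ext i; exact i.elim0⟩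
  | succ n ih =>
    intro T hT F d E F' d' E' h h'
    obtain ⟨u, hu⟩ : IsUnit (T 0 0) := by
      rw [PowerSeries.isUnit_iff_constantCoeff, hT]; simp
    have key : ∀ {F d E}, IsGaussFactorization T F d E → d 0 = T 0 0 ∧
        (∀ j : Fin n, E 0 j.succ = (↑u⁻¹ : PowerSeries A) * T 0 j.succ) ∧
        (∀ i : Fin n, F i.succ 0 = T i.succ 0 * (↑u⁻¹ : PowerSeries A)) ∧
        IsGaussFactorization (Matrix.of fun i j : Fin n =>
            T i.succ j.succ - T i.succ 0 * (↑u⁻¹ : PowerSeries A) * T 0 j.succ)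
          (Matrix.of fun i j : Fin n => F i.succ j.succ) (fun i => d i.succ)
          (Matrix.of fun i j : Fin n => E i.succ j.succ) := by
      intro F d E h
      have hm := isGaussFactorization_apply h
      simp only [Fin.sum_univ_succ] at hm
      have hF0 : ∀ j : Fin n, F 0 j.succ = 0 := fun j => h.lower_zero _ _ (Fin.succ_pos j)
      have hE0 : ∀ j : Fin n, E j.succ 0 = 0 := fun j => h.upper_zero _ _ (Fin.succ_pos j)
      have hd : d 0 = u := by
        rw [hu, ← hm 0 0]; simp [hF0, h.lower_diag, h.upper_diag]
      have hE : ∀ j : Fin n, E 0 j.succ = (↑u⁻¹ : PowerSeries A) * T 0 j.succ := by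
        intro j
        rw [← hm 0 j.succ]; simp [hF0, h.lower_diag, hd]
      have hF : ∀ i : Fin n, F i.succ 0 = T i.succ 0 * (↑u⁻¹ : PowerSeries A) := by
        intro i
        rw [← hm i.succ 0]; simp [hE0, h.upper_diag, hd]
      refine ⟨hd.trans hu, hE, hF, fun i => h.lower_diag _,
        fun i j hij => h.lower_zero _ _ (Fin.succ_lt_succ_iff.mpr hij), fun i => h.upper_diag _,
        fun i j hij => h.upper_zero _ _ (Fin.succ_lt_succ_iff.mpr hij), ?_⟩
      ext1 i j
      simp only [Matrix.mul_apply (M := _ * _), Matrix.mul_diagonal, Matrix.of_apply]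
      rw [← hm i.succ j.succ, hF, hE, hd]
      simp [mul_assoc]
    obtain ⟨hd, hE, hF, hS⟩ := key h
    obtain ⟨hd', hE', hF', hS'⟩ := key h'
    obtain ⟨e1, e2, e3⟩ := ih _ (by intro i j; simp [hT]) hS hS'
    refine ⟨?_, ?_, ?_⟩
    · ext1 i j
      cases i using Fin.cases with
      | zero =>
        cases j using Fin.cases with
        | zero => rw [h.lower_diag, h'.lower_diag]
        | succ j => rw [h.lower_zero _ _ (Fin.succ_pos j), h'.lower_zero _ _ (Fin.succ_pos j)]
      | succ i =>
        cases j using Fin.cases with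
        | zero => rw [hF, hF']
        | succ j => exact congrFun (congrFun e1 i) j
    · funext i
      cases i using Fin.cases with
      | zero => rw [hd, hd']
      | succ i => exact congrFun e2 i
    · ext1 i j
      cases i using Fin.cases with
      | zero =>
        cases j using Fin.cases with
        | zero => rw [h.upper_diag, h'.upper_diag]
        | succ j => rw [hE, hE']
      | succ i =>
        cases j using Fin.cases with
        | zero => rw [h.upper_zero _ _ (Fin.succ_pos i), h'.upper_zero _ _ (Fin.succ_pos i)]
        | succ j => exact congrFun (congrFun e3 i) j

namespace Yangian

/-- The symbol `T_{i,j}^{(r)}` in the free algebra: it is `δ_{i,j}` for `r = 0`, and the free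
generator with index `(i, j, r - 1)` for `r ≥ 1`. -/
noncomputable def freeT (n : ℕ) (i j : Fin n) : ℕ → FreeAlgebra ℂ (Fin n × Fin n × ℕ)
  | 0 => if i = j then 1 else 0
  | r + 1 => FreeAlgebra.ι ℂ (i, j, r)

/-- The RTT relations, i.e. the `u^{-r} v^{-s}`-coefficients of
`(u - v) [T_{i,j}(u), T_{h,k}(v)] = T_{h,j}(u) T_{i,k}(v) - T_{h,j}(v) T_{i,k}(u)`. -/
inductive Rel (n : ℕ) :
    FreeAlgebra ℂ (Fin n × Fin n × ℕ) → FreeAlgebra ℂ (Fin n × Fin n × ℕ) → Prop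
  | rtt (i j h k : Fin n) (r s : ℕ) :
    Rel n (⁅freeT n i j (r + 1), freeT n h k s⁆ - ⁅freeT n i j r, freeT n h k (s + 1)⁆)
      (freeT n h j r * freeT n i k s - freeT n h j s * freeT n i k r)

end Yangian

/-- The Yangian `Y_n = Y(gl_n)` over `ℂ`. -/
abbrev Yangian (n : ℕ) : Type := RingQuot (Yangian.Rel n)

namespace Yangian

/-- The element `T_{i,j}^{(r)}` of `Y_n`, with `T_{i,j}^{(0)} = δ_{i,j}`. -/
noncomputable def T (n : ℕ) (i j : Fin n) (r : ℕ) : Yangian n :=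
  RingQuot.mkAlgHom ℂ (Rel n) (freeT n i j r)

/-- The matrix `T(u)` with entries `T_{i,j}(u) = ∑_{r ≥ 0} T_{i,j}^{(r)} u^{-r}`; the variable of
the power series stands for `u^{-1}`. -/
noncomputable def TMatrix (n : ℕ) : Matrix (Fin n) (Fin n) (PowerSeries (Yangian n)) :=
  Matrix.of fun i j => PowerSeries.mk (T n i j)

/-- `T(u)` has a Gauss factorization `T(u) = F(u) D(u) E(u)`, and only one. -/
theorem existsUnique_gauss (n : ℕ) :
    ∃! p : Matrix (Fin n) (Fin n) (PowerSeries (Yangian n)) ×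
        (Fin n → PowerSeries (Yangian n)) × Matrix (Fin n) (Fin n) (PowerSeries (Yangian n)),
      IsGaussFactorization (TMatrix n) p.1 p.2.1 p.2.2 := by
  have h0 : ∀ i j, PowerSeries.constantCoeff (TMatrix n i j) = if i = j then 1 else 0 := by
    intro i j
    rw [← PowerSeries.coeff_zero_eq_constantCoeff_apply]
    simp only [TMatrix, Matrix.of_apply, PowerSeries.coeff_mk, T, freeT]
    split_ifs <;> simp
  obtain ⟨F, d, E, h⟩ := exists_isGaussFactorization n (TMatrix n) h0
  refine ⟨(F, d, E), h, ?_⟩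
  rintro ⟨F', d', E'⟩ h'
  obtain ⟨e1, e2, e3⟩ := isGaussFactorization_unique n (TMatrix n) h0 h' h
  exact Prod.ext e1 (Prod.ext e2 e3)

/-- The series `D_i(u) = ∑_{r ≥ 0} D_i^{(r)} u^{-r}`: the diagonal entries of the diagonal factor
in the unique Gauss factorization of `T(u)`. -/
noncomputable def DSeries (n : ℕ) (i : Fin n) : PowerSeries (Yangian n) :=
  (existsUnique_gauss n).choose.2.1 i

/-- The element `D_i^{(r)}` of `Y_n`. -/
noncomputable def D (n : ℕ) (i : Fin n) (r : ℕ) : Yangian n :=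
  PowerSeries.coeff r (DSeries n i)

/-- The Cartan subalgebra `Y_{(1^n)}` of `Y_n`, generated by all `D_i^{(r)}`. -/
noncomputable def cartan (n : ℕ) : Subalgebra ℂ (Yangian n) :=
  Algebra.adjoin ℂ {x | ∃ i r, x = D n i r}

end Yangian

/-! Commutativity. An inverse of a solution of the RTT relation solves it with `u` and `v`
exchanged, corner blocks of solutions are solutions, and the lower right block of `T⁻¹` is the
inverse of the Schur complement of the top left entry. Hence that Schur complement again solves the
relation, and the same relation shows that it commutes with the top left entry. As the remaining
diagonal Gauss factors are those of the Schur complement, induction on `n` makes all `D_i^{(r)}`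
commute (`IsRTT.commute_diag`).

Maximality. It suffices that the Cartan subalgebra is its own centralizer. Give `T_{i,j}^{(r+1)}`
the weight `(r, 1)`, loop degree and number of factors, ordered lexicographically. A commutator of
two generators has the same loop degree as their product, up to smaller loop degree, but only one
factor. So generators commute modulo lower weight, and elements of `Y_n` have leading terms in the
commutative polynomial ring on the generators. These are unique by the Poincaré–Birkhoff–Witt
theorem (`orderedEval_injective`).

On leading terms, the commutator with `D_i^{(a+1)}` acts by the derivation sending `x_{h,k}^{(s)}`
to `(δ_{h,i} - δ_{k,i}) x_{h,k}^{(s+a)}`. A polynomial killed by all of these involves only diagonal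
variables (`diag_of_shiftDer_eq_zero`). Since `D_i^{(r)}` and `T_{i,i}^{(r)}` have the same leading
term, an element centralizing the Cartan subalgebra agrees to leading order with a polynomial in the
`D_i^{(r)}`. Subtracting it lowers the weight, and well-founded induction finishes.

Linear independence of ordered monomials is proved by representations. Products of `L` factors `1 +
e u^{-1}`, with `e` satisfying the `gl_n` relations, solve the RTT relation. With `e` realized as
multiplication by matrix entries plus a vector field, the symbol of `T(u)` is a product of generic
factors `1 + x u^{-1}`. Products of such factors over `ℂ` reach every prescribed finite set of
coefficients (`exists_coeff_linProd_eq`), so no nonzero polynomial vanishes on all the symbols. -/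

open PowerSeries

/-! ### Formal consequences of the RTT relation over a ring: inversion, blocks, products. -/

section RTTAbstract

variable {R : Type*} [Ring R] {n : ℕ}

/-- The RTT relation between two matrices over a ring, with `z` and `w` in the roles of `u - v` and
of the structure constant. -/
def RTTRel (z w : R) (S U : Matrix (Fin n) (Fin n) R) : Prop :=
  ∀ i j h k, z * (S i j * U h k - U h k * S i j) = w * (S h j * U i k - U h j * S i k)

/-- In matrix form this is `U⁻¹ [s, U] U⁻¹ = [U⁻¹, s]`, the rule for commuting past an inverse. -/
theorem sandwich_eq {U U' : Matrix (Fin n) (Fin n) R} (h1 : U * U' = 1) (h2 : U' * U = 1)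
    (s : R) (p q : Fin n) :
    ∑ h, ∑ k, U' p h * (s * U h k - U h k * s) * U' k q = U' p q * s - s * U' p q := by
  have e1 : ∀ h, ∑ k, U h k * U' k q = if h = q then 1 else 0 := fun h => by
    rw [← Matrix.mul_apply, h1, Matrix.one_apply]
  have e2 : ∀ k, ∑ h, U' p h * U h k = if p = k then 1 else 0 := fun k => by
    rw [← Matrix.mul_apply, h2, Matrix.one_apply]
  simp only [mul_sub, sub_mul, Finset.sum_sub_distrib]
  congr 1
  · have : ∀ h, ∑ k, U' p h * (s * U h k) * U' k q = U' p h * s * ∑ k, U h k * U' k q := fun h => by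
      simp only [Finset.mul_sum, mul_assoc]
    simp [this, e1]
  · rw [Finset.sum_comm]
    have : ∀ k, ∑ h, U' p h * (U h k * s) * U' k q = (∑ h, U' p h * U h k) * (s * U' k q) :=
      fun k => by simp only [Finset.sum_mul, mul_assoc]
    simp [this, e2]

/-- Sandwich the relation between two copies of `U⁻¹`: on the right, `U` meets its inverse and
leaves Kronecker deltas. -/
theorem RTTRel.mixed {z w : R} (hz : ∀ a, Commute z a) (hw : ∀ a, Commute w a)
    {S U U' : Matrix (Fin n) (Fin n) R} (H : RTTRel z w S U) (h1 : U * U' = 1) (h2 : U' * U = 1)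
    (p q i j : Fin n) :
    z * (U' p q * S i j - S i j * U' p q) =
      w * ((if i = q then (U' * S) p j else 0) - if p = j then (S * U') i q else 0) := by
  have e1 : ∀ h, ∑ k, U h k * U' k q = if h = q then 1 else 0 := fun h => by
    rw [← Matrix.mul_apply, h1, Matrix.one_apply]
  have e2 : ∀ k, ∑ h, U' p h * U h k = if p = k then 1 else 0 := fun k => by
    rw [← Matrix.mul_apply, h2, Matrix.one_apply]
  have key : ∀ h k, z * (U' p h * (S i j * U h k - U h k * S i j) * U' k q) =
      w * (U' p h * S h j * (U i k * U' k q) - U' p h * U h j * (S i k * U' k q)) := fun h k => by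
    calc _ = U' p h * (z * (S i j * U h k - U h k * S i j)) * U' k q := by
          rw [← mul_assoc, ← mul_assoc, (hz (U' p h)).eq, mul_assoc (U' p h) z]
      _ = _ := by
          rw [H, ← mul_assoc (U' p h), ← (hw (U' p h)).eq]
          simp only [mul_sub, sub_mul, mul_assoc]
  rw [← sandwich_eq h1 h2, Finset.mul_sum]
  simp only [Finset.mul_sum, key]
  simp only [← Finset.mul_sum, Finset.sum_sub_distrib]
  congr 2
  · simp only [e1]
    split_ifs with hi <;> simp [Matrix.mul_apply]
  · simp only [← Finset.sum_mul, e2]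
    split_ifs with hi <;> simp [Matrix.mul_apply]

/-- A second sandwich, of the mixed relation between two copies of `S⁻¹`, removes the deltas. The
two matrices come out in exchanged roles. -/
theorem RTTRel.inv {z w : R} (hz : ∀ a, Commute z a) (hw : ∀ a, Commute w a)
    {S U S' U' : Matrix (Fin n) (Fin n) R} (H : RTTRel z w S U)
    (hS1 : S * S' = 1) (hS2 : S' * S = 1) (hU1 : U * U' = 1) (hU2 : U' * U = 1) :
    RTTRel z w U' S' := by
  intro p q a b
  have key : ∀ i j, z * (S' a i * (U' p q * S i j - S i j * U' p q) * S' j b) =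
      w * ((if i = q then S' a i * ((U' * S) p j * S' j b) else 0) -
        if p = j then S' a i * ((S * U') i q * S' j b) else 0) := fun i j => by
    calc _ = S' a i * (z * (U' p q * S i j - S i j * U' p q)) * S' j b := by
          rw [← mul_assoc, ← mul_assoc, (hz (S' a i)).eq, mul_assoc (S' a i) z]
      _ = _ := by
          rw [H.mixed hz hw hU1 hU2, ← mul_assoc (S' a i), ← (hw (S' a i)).eq]
          split_ifs <;> simp only [mul_sub, sub_mul, mul_assoc, mul_zero, zero_mul]
  have hs := sandwich_eq hS1 hS2 (U' p q) a b
  have e : z * (S' a b * U' p q - U' p q * S' a b) =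
      w * (S' a q * U' p b - U' a q * S' p b) := by
    rw [← hs]
    simp only [Finset.mul_sum, key]
    simp only [← Finset.mul_sum, Finset.sum_sub_distrib]
    congr 2
    · rw [Finset.sum_comm]
      simp only [Finset.sum_ite_eq', Finset.mem_univ, if_true]
      rw [← Finset.mul_sum, ← Matrix.mul_apply, mul_assoc, hS1, mul_one]
    · simp only [Finset.sum_ite_eq, Finset.mem_univ, if_true]
      simp only [← mul_assoc]
      rw [← Finset.sum_mul, ← Matrix.mul_apply, ← mul_assoc, hS2, one_mul]
  rw [← neg_sub, mul_neg, e, ← mul_neg, neg_sub]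

theorem RTTRel.submatrix {z w : R} {m : ℕ} {S U : Matrix (Fin n) (Fin n) R} (H : RTTRel z w S U)
    (f : Fin m → Fin n) : RTTRel z w (S.submatrix f f) (U.submatrix f f) :=
  fun i j h k => H (f i) (f j) (f h) (f k)

/-- This underlies the coproduct of the Yangian. The two middle terms in `key` cancel after
exchanging the summation indices `p` and `q`. -/
theorem RTTRel.mul {z w : R} (hz : ∀ a, Commute z a) (hw : ∀ a, Commute w a)
    {S U S₂ U₂ : Matrix (Fin n) (Fin n) R} (H : RTTRel z w S U) (H₂ : RTTRel z w S₂ U₂)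
    (hSU : ∀ i j h k, Commute (S₂ i j) (U h k)) (hUS : ∀ i j h k, Commute (U₂ i j) (S h k)) :
    RTTRel z w (S * S₂) (U * U₂) := by
  intro i j h k
  have key : ∀ p q,
      z * ((S i p * S₂ p j) * (U h q * U₂ q k) - (U h q * U₂ q k) * (S i p * S₂ p j)) =
      w * ((S h p * S₂ p j) * (U i q * U₂ q k) - U h p * S i q * (S₂ p j * U₂ q k) +
        U h q * S i p * (S₂ q j * U₂ p k) - (U h q * U₂ q j) * (S i p * S₂ p k)) := fun p q => by
    calc _ = z * (S i p * U h q - U h q * S i p) * (S₂ p j * U₂ q k) +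
          U h q * S i p * (z * (S₂ p j * U₂ q k - U₂ q k * S₂ p j)) := by
          rw [mul_assoc (S i p), ← mul_assoc (S₂ p j), (hSU p j h q).eq,
            mul_assoc (U h q) (U₂ q k), ← mul_assoc (U₂ q k), (hUS q k i p).eq,
            ← mul_assoc _ z, ← (hz (U h q * S i p)).eq]
          noncomm_ring
      _ = _ := by
          rw [H, H₂, ← mul_assoc _ w, ← (hw (U h q * S i p)).eq,
            mul_assoc (S h p), ← mul_assoc (S₂ p j), (hSU p j i q).eq,
            mul_assoc (U h q) (U₂ q j), ← mul_assoc (U₂ q j), (hUS q j i p).eq]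
          noncomm_ring
  simp only [Matrix.mul_apply, Finset.sum_mul_sum]
  rw [Finset.sum_comm (f := fun q p => U h q * U₂ q k * (S i p * S₂ p j)),
    Finset.sum_comm (f := fun q p => U h q * U₂ q j * (S i p * S₂ p k))]
  simp only [← Finset.sum_sub_distrib]
  simp only [Finset.mul_sum, key]
  simp only [← Finset.mul_sum]
  congr 1
  simp only [Finset.sum_sub_distrib, Finset.sum_add_distrib]
  rw [Finset.sum_comm (f := fun p q => U h q * S i p * (S₂ q j * U₂ p k))]
  abel

end RTTAbstract

/-! ### The RTT relation for power series, and its inheritance by Schur complements. -/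

section RTTSeries

variable {A : Type*} [Ring A] {n : ℕ}

/-- The RTT relation
`(u - v) [T_{i,j}(u), T_{h,k}(v)] = T_{h,j}(u) T_{i,k}(v) - T_{h,j}(v) T_{i,k}(u)`
for a matrix of power series, multiplied by `u^{-1} v^{-1}`. In `A⟦X⟧⟦X⟧` the outer variable stands
for `u^{-1}` and the inner one for `v^{-1}`. -/
def IsRTT (T : Matrix (Fin n) (Fin n) A⟦X⟧) : Prop :=
  RTTRel (C X - X : A⟦X⟧⟦X⟧) (C X * X) (T.map (PowerSeries.map C)) (T.map C)

theorem commute_X_all (a : A⟦X⟧⟦X⟧) : Commute X a := (commute_X a).symm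

theorem commute_C_X (a : A⟦X⟧⟦X⟧) : Commute (C X) a := by
  ext1 r
  rw [coeff_C_mul, coeff_mul_C, (commute_X _).eq]

theorem coeff_coeff_map_mul_C (f g : A⟦X⟧) (r s : ℕ) :
    coeff s (coeff r (PowerSeries.map C f * C g)) = coeff r f * coeff s g := by
  simp

theorem coeff_coeff_C_mul_map (f g : A⟦X⟧) (r s : ℕ) :
    coeff s (coeff r (C g * PowerSeries.map C f)) = coeff s g * coeff r f := by
  simp

theorem isRTT_iff {T : Matrix (Fin n) (Fin n) A⟦X⟧}
    (h0 : ∀ i j, coeff 0 (T i j) = if i = j then 1 else 0) :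
    IsRTT T ↔ ∀ i j h k r s,
      ⁅coeff (r + 1) (T i j), coeff s (T h k)⁆ - ⁅coeff r (T i j), coeff (s + 1) (T h k)⁆ =
        coeff r (T h j) * coeff s (T i k) - coeff s (T h j) * coeff r (T i k) := by
  simp only [Ring.lie_def]
  constructor
  · intro H i j h k r s
    have := congrArg (fun f => coeff (s + 1) (coeff (r + 1) f)) (H i j h k)
    simp only [sub_mul, mul_assoc, map_sub, coeff_C_mul (a := (X : A⟦X⟧)),
      coeff_succ_X_mul, Matrix.map_apply, coeff_coeff_map_mul_C, coeff_coeff_C_mul_map] at this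
    exact this
  · intro H i j h k
    ext r s
    simp only [sub_mul, mul_assoc, map_sub, coeff_C_mul (a := (X : A⟦X⟧)), Matrix.map_apply]
    rcases r with _ | r <;> rcases s with _ | s <;>
      simp only [coeff_zero_X_mul, coeff_succ_X_mul, coeff_coeff_map_mul_C,
        coeff_coeff_C_mul_map, map_sub, sub_zero, mul_zero, map_zero, zero_sub]
    -- The coefficients with exponent zero in one variable only say that the scalar constant terms
    -- of `T` commute with everything.
    · rw [h0]; split_ifs <;> simp
    · rw [h0]; split_ifs <;> simp
    · exact H i j h k r s

/-- Comparing powers of the outer variable gives `X f_0 = 0` and `X f_{r+1} = c f_r`, so the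
coefficients vanish one after another. -/
theorem eq_zero_of_C_X_mul {b f : A⟦X⟧⟦X⟧} (c : A⟦X⟧) (hb : b = C c)
    (h : C X * f = X * (b * f)) : f = 0 := by
  subst hb
  ext1 r
  induction r with
  | zero =>
    have := congrArg (coeff 0) h
    rw [coeff_C_mul, coeff_zero_X_mul] at this
    exact X_mul_cancel (by simpa using this)
  | succ r ih =>
    have := congrArg (coeff (r + 1)) h
    rw [coeff_C_mul, coeff_succ_X_mul, coeff_C_mul, ih] at this
    exact X_mul_cancel (by simpa using this)

theorem eq_zero_of_mul_eq_zero {f : A⟦X⟧⟦X⟧} (h : (C X - X) * f = 0) : f = 0 := by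
  refine eq_zero_of_C_X_mul 1 (map_one C).symm ?_
  rw [sub_mul, sub_eq_zero] at h
  rw [h, one_mul]

theorem IsRTT.commute_apply_self {T : Matrix (Fin n) (Fin n) A⟦X⟧} (H : IsRTT T) (i : Fin n)
    (r s : ℕ) : Commute (coeff r (T i i)) (coeff s (T i i)) := by
  have := H i i i i
  simp only [Matrix.map_apply] at this
  have h0 : PowerSeries.map C (T i i) * C (T i i) - C (T i i) * PowerSeries.map C (T i i) = 0 := by
    -- With all indices equal, the right side of the relation is also a multiple of the commutator,
    -- which is thus killed by `v^{-1} - u^{-1} - u^{-1} v^{-1}`.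
    refine eq_zero_of_C_X_mul (1 + X) rfl ?_
    rw [sub_mul, sub_eq_iff_eq_add] at this
    rw [this, (commute_C_X X).eq, map_add, map_one, add_mul, mul_add, mul_assoc, one_mul, add_comm]
  have := congrArg (fun f => coeff s (coeff r f)) h0
  simp only [map_sub, coeff_coeff_map_mul_C, coeff_coeff_C_mul_map, map_zero, sub_eq_zero] at this
  exact this

/-- A matrix of power series with constant term `1` is invertible. -/
theorem exists_matrix_inv (T : Matrix (Fin n) (Fin n) A⟦X⟧)
    (h0 : ∀ i j, coeff 0 (T i j) = if i = j then 1 else 0) :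
    ∃ T' : Matrix (Fin n) (Fin n) A⟦X⟧, T * T' = 1 ∧ T' * T = 1 := by
  -- A matrix of power series is read as a power series of matrices, which is a unit as soon as its
  -- constant term is.
  let φ : (Matrix (Fin n) (Fin n) A)⟦X⟧ → Matrix (Fin n) (Fin n) A⟦X⟧ :=
    fun f => Matrix.of fun i j => PowerSeries.mk fun r => coeff r f i j
  have hmul : ∀ f g, φ (f * g) = φ f * φ g := fun f g => by
    ext i j r
    simp only [φ, Matrix.of_apply, coeff_mk, coeff_mul, Matrix.mul_apply, Matrix.sum_apply, map_sum]
    exact Finset.sum_comm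
  have hone : φ 1 = 1 := by
    ext i j r
    simp only [φ, Matrix.of_apply, coeff_mk, coeff_one, Matrix.one_apply]
    split_ifs <;> simp_all [Matrix.one_apply]
  obtain ⟨u, hu⟩ : IsUnit (PowerSeries.mk fun r => Matrix.of fun i j => coeff r (T i j)) := by
    rw [PowerSeries.isUnit_iff_constantCoeff, ← coeff_zero_eq_constantCoeff_apply, coeff_mk]
    convert isUnit_one
    ext i j
    simp [h0, Matrix.one_apply]
  have hT : φ u = T := by
    rw [hu]; ext i j r
    simp [φ]
  exact ⟨φ ↑u⁻¹, by rw [← hT, ← hmul, u.mul_inv, hone], by rw [← hT, ← hmul, u.inv_mul, hone]⟩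

/-- The Schur complement of the top left entry `u` of `T`. -/
noncomputable def schurCompl (T : Matrix (Fin (n + 1)) (Fin (n + 1)) A⟦X⟧) (u : A⟦X⟧ˣ) :
    Matrix (Fin n) (Fin n) A⟦X⟧ :=
  Matrix.of fun i j => T i.succ j.succ - T i.succ 0 * (↑u⁻¹ : A⟦X⟧) * T 0 j.succ

theorem coeff_zero_schur {T : Matrix (Fin (n + 1)) (Fin (n + 1)) A⟦X⟧} (u : A⟦X⟧ˣ)
    (h0 : ∀ i j, coeff 0 (T i j) = if i = j then 1 else 0) (i j : Fin n) :
    coeff 0 (schurCompl T u i j) = if i = j then 1 else 0 := by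
  simp only [coeff_zero_eq_constantCoeff_apply] at h0
  simp [schurCompl, h0]

/-- Block inversion: this is how properties of the blocks of `T⁻¹` reach the Schur complement. -/
theorem schur_mul_inv {T T' : Matrix (Fin (n + 1)) (Fin (n + 1)) A⟦X⟧} {u : A⟦X⟧ˣ}
    (hu : u = T 0 0) (h1 : T * T' = 1) (h2 : T' * T = 1) :
    schurCompl T u * T'.submatrix Fin.succ Fin.succ = 1 ∧
      T'.submatrix Fin.succ Fin.succ * schurCompl T u = 1 := by
  have e1 : ∀ i j, T i 0 * T' 0 j + ∑ k : Fin n, T i k.succ * T' k.succ j =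
      (1 : Matrix (Fin (n + 1)) (Fin (n + 1)) A⟦X⟧) i j := fun i j => by
    rw [← h1, Matrix.mul_apply, Fin.sum_univ_succ]
  have e2 : ∀ i j, T' i 0 * T 0 j + ∑ k : Fin n, T' i k.succ * T k.succ j =
      (1 : Matrix (Fin (n + 1)) (Fin (n + 1)) A⟦X⟧) i j := fun i j => by
    rw [← h2, Matrix.mul_apply, Fin.sum_univ_succ]
  constructor
  · ext1 i j
    have a := e1 0 j.succ
    have b := e1 i.succ j.succ
    simp only [Matrix.one_apply, Fin.succ_inj, (Fin.succ_ne_zero _).symm, if_false] at a b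
    simp only [Matrix.mul_apply, schurCompl, Matrix.of_apply, Matrix.submatrix_apply, sub_mul,
      Finset.sum_sub_distrib, Matrix.one_apply, mul_assoc]
    simp only [← Finset.mul_sum]
    rw [← hu] at a
    rw [← b, eq_neg_of_add_eq_zero_right a, mul_neg, mul_neg, u.inv_mul_cancel_left]
    abel
  · ext1 i j
    have a := e2 i.succ 0
    have b := e2 i.succ j.succ
    simp only [Matrix.one_apply, Fin.succ_inj, Fin.succ_ne_zero, if_false] at a b
    simp only [Matrix.mul_apply, schurCompl, Matrix.of_apply, Matrix.submatrix_apply, mul_sub,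
      Finset.sum_sub_distrib, Matrix.one_apply, ← mul_assoc]
    simp only [← Finset.sum_mul]
    rw [← hu] at a
    rw [← b, eq_neg_of_add_eq_zero_right a, neg_mul, neg_mul, mul_assoc _ (u : A⟦X⟧), u.mul_inv]
    simp only [mul_one]
    abel

theorem matrix_map_mul_eq_one {R S : Type*} [Ring R] [Ring S] (f : R →+* S)
    {M N : Matrix (Fin n) (Fin n) R} (h : M * N = 1) : M.map f * N.map f = 1 := by
  rw [← Matrix.map_mul, h, Matrix.map_one _ (map_zero f) (map_one f)]

theorem map_outer_mul {S T : Matrix (Fin n) (Fin n) A⟦X⟧} (h : S * T = 1) :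
    S.map (PowerSeries.map (C : A →+* A⟦X⟧)) * T.map (PowerSeries.map (C : A →+* A⟦X⟧)) = 1 :=
  matrix_map_mul_eq_one (PowerSeries.map (C : A →+* A⟦X⟧)) h

theorem map_inner_mul {S T : Matrix (Fin n) (Fin n) A⟦X⟧} (h : S * T = 1) :
    S.map (C : A⟦X⟧ →+* A⟦X⟧⟦X⟧) * T.map (C : A⟦X⟧ →+* A⟦X⟧⟦X⟧) = 1 :=
  matrix_map_mul_eq_one (C : A⟦X⟧ →+* A⟦X⟧⟦X⟧) h

theorem commute_C_X_sub_X (a : A⟦X⟧⟦X⟧) : Commute (C X - X) a :=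
  (commute_C_X a).sub_left (commute_X_all a)

theorem commute_C_X_mul_X (a : A⟦X⟧⟦X⟧) : Commute (C X * X) a :=
  (commute_C_X a).mul_left (commute_X_all a)

theorem IsRTT.inv {T T' : Matrix (Fin n) (Fin n) A⟦X⟧} (H : IsRTT T) (h1 : T * T' = 1)
    (h2 : T' * T = 1) :
    RTTRel (C X - X : A⟦X⟧⟦X⟧) (C X * X) (T'.map C) (T'.map (PowerSeries.map C)) :=
  RTTRel.inv commute_C_X_sub_X commute_C_X_mul_X H (map_outer_mul h1) (map_outer_mul h2)
    (map_inner_mul h1) (map_inner_mul h2)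

/-- Inversion exchanges `u` and `v`, so a second inversion restores the original form of the
relation. -/
theorem isRTT_of_inv {T T' : Matrix (Fin n) (Fin n) A⟦X⟧} (h1 : T * T' = 1) (h2 : T' * T = 1)
    (H : RTTRel (C X - X : A⟦X⟧⟦X⟧) (C X * X) (T'.map C) (T'.map (PowerSeries.map C))) : IsRTT T :=
  RTTRel.inv commute_C_X_sub_X commute_C_X_mul_X H (map_inner_mul h2) (map_inner_mul h1)
    (map_outer_mul h2) (map_outer_mul h1)

/-- Both deltas of the mixed relation vanish for these indices, and `u - v` is not a zero divisor.
-/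
theorem IsRTT.commute_inv {T T' : Matrix (Fin (n + 1)) (Fin (n + 1)) A⟦X⟧} (H : IsRTT T)
    (h1 : T * T' = 1) (h2 : T' * T = 1) (i j : Fin n) :
    Commute (PowerSeries.map C (T 0 0)) (C (T' i.succ j.succ)) := by
  have := RTTRel.mixed commute_C_X_sub_X commute_C_X_mul_X H (map_inner_mul h1) (map_inner_mul h2)
    i.succ j.succ 0 0
  simp only [(Fin.succ_ne_zero _).symm, Fin.succ_ne_zero, if_false, sub_zero, mul_zero] at this
  exact (sub_eq_zero.mp (eq_zero_of_mul_eq_zero this)).symm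

theorem commute_of_commute_inv {S T : Matrix (Fin n) (Fin n) A⟦X⟧} {f : A⟦X⟧} (h1 : S * T = 1)
    (h2 : T * S = 1) (hc : ∀ i j, Commute (PowerSeries.map C f) (C (T i j))) (i j : Fin n)
    (r s : ℕ) :
    Commute (coeff r f) (coeff s (S i j)) := by
  have := sandwich_eq (map_inner_mul h2) (map_inner_mul h1) (PowerSeries.map C f) i j
  simp only [Matrix.map_apply, (hc _ _).eq, sub_self, mul_zero, zero_mul,
    Finset.sum_const_zero] at this
  have := congrArg (fun f => coeff s (coeff r f)) this
  simp only [map_sub, coeff_coeff_map_mul_C, coeff_coeff_C_mul_map, map_zero] at this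
  exact (sub_eq_zero.mp this.symm).symm

theorem IsRTT.schur {T : Matrix (Fin (n + 1)) (Fin (n + 1)) A⟦X⟧} (H : IsRTT T)
    (h0 : ∀ i j, coeff 0 (T i j) = if i = j then 1 else 0) {u : A⟦X⟧ˣ} (hu : u = T 0 0) :
    IsRTT (schurCompl T u) ∧
      ∀ i j r s, Commute (coeff r (T 0 0)) (coeff s (schurCompl T u i j)) := by
  obtain ⟨T', h1, h2⟩ := exists_matrix_inv T h0
  obtain ⟨g1, g2⟩ := schur_mul_inv hu h1 h2
  exact ⟨isRTT_of_inv g1 g2 ((H.inv h1 h2).submatrix Fin.succ),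
    commute_of_commute_inv g1 g2 (H.commute_inv h1 h2)⟩

end RTTSeries

/-! ### Commutativity of the diagonal Gauss factors. -/

section Gauss

variable {A : Type*} [Ring A] {n : ℕ}

theorem IsGaussFactorization.schur {T F E : Matrix (Fin (n + 1)) (Fin (n + 1)) A⟦X⟧}
    {d : Fin (n + 1) → A⟦X⟧} (h : IsGaussFactorization T F d E) {u : A⟦X⟧ˣ} (hu : u = T 0 0) :
    d 0 = T 0 0 ∧ IsGaussFactorization (schurCompl T u) (F.submatrix Fin.succ Fin.succ)
      (fun i => d i.succ) (E.submatrix Fin.succ Fin.succ) := by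
  have hm := isGaussFactorization_apply h
  simp only [Fin.sum_univ_succ] at hm
  have hF0 : ∀ j : Fin n, F 0 j.succ = 0 := fun j => h.lower_zero _ _ (Fin.succ_pos j)
  have hE0 : ∀ j : Fin n, E j.succ 0 = 0 := fun j => h.upper_zero _ _ (Fin.succ_pos j)
  have hd : d 0 = u := by
    rw [hu, ← hm 0 0]; simp [hF0, h.lower_diag, h.upper_diag]
  refine ⟨hd.trans hu, fun i => h.lower_diag _,
    fun i j hij => h.lower_zero _ _ (Fin.succ_lt_succ_iff.mpr hij), fun i => h.upper_diag _,
    fun i j hij => h.upper_zero _ _ (Fin.succ_lt_succ_iff.mpr hij), ?_⟩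
  have hE : ∀ j : Fin n, E 0 j.succ = (↑u⁻¹ : A⟦X⟧) * T 0 j.succ := by
    intro j
    rw [← hm 0 j.succ]; simp [hF0, h.lower_diag, hd]
  have hF : ∀ i : Fin n, F i.succ 0 = T i.succ 0 * (↑u⁻¹ : A⟦X⟧) := by
    intro i
    rw [← hm i.succ 0]; simp [hE0, h.upper_diag, hd]
  ext1 i j
  simp only [Matrix.mul_apply (M := _ * _), Matrix.mul_diagonal, schurCompl, Matrix.of_apply,
    Matrix.submatrix_apply]
  rw [← hm i.succ j.succ, hF, hE, hd]
  simp [mul_assoc]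

theorem exists_unit_apply_zero {T : Matrix (Fin (n + 1)) (Fin (n + 1)) A⟦X⟧}
    (h0 : ∀ i j, coeff 0 (T i j) = if i = j then 1 else 0) : ∃ u : A⟦X⟧ˣ, u = T 0 0 := by
  have : IsUnit (T 0 0) := by
    rw [PowerSeries.isUnit_iff_constantCoeff, ← coeff_zero_eq_constantCoeff_apply, h0]; simp
  exact this

/-- The diagonal factors are built from the entries of `T` by ring operations and inverses of units,
all of which preserve commutation with `c`. -/
theorem commute_gauss {n : ℕ} : ∀ {T F E : Matrix (Fin n) (Fin n) A⟦X⟧} {d : Fin n → A⟦X⟧},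
    (∀ i j, coeff 0 (T i j) = if i = j then 1 else 0) → IsGaussFactorization T F d E →
    ∀ {c : A⟦X⟧}, (∀ i j, Commute c (T i j)) → ∀ i, Commute c (d i) := by
  induction n with
  | zero => exact fun _ _ _ _ i => i.elim0
  | succ n ih =>
    intro T F E d h0 h c hc i
    obtain ⟨u, hu⟩ := exists_unit_apply_zero h0
    obtain ⟨hd, hs⟩ := h.schur hu
    cases i using Fin.cases with
    | zero => rw [hd]; exact hc 0 0
    | succ i =>
      refine ih (coeff_zero_schur u h0) hs (fun i j => ?_) i
      have hu' : Commute c (↑u⁻¹ : A⟦X⟧) := (hu ▸ hc 0 0 : Commute c u).units_inv_right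
      exact (hc _ _).sub_right (((hc _ _).mul_right hu').mul_right (hc _ _))

theorem commute_C_iff (a : A) (f : A⟦X⟧) : Commute (C a) f ↔ ∀ r, Commute a (coeff r f) := by
  simp only [Commute, SemiconjBy, PowerSeries.ext_iff, coeff_C_mul, coeff_mul_C]

/-- The coefficients of the diagonal entries in the Gauss factorization of a solution of the RTT
relation commute with each other. -/
theorem IsRTT.commute_diag {n : ℕ} : ∀ {T F E : Matrix (Fin n) (Fin n) A⟦X⟧} {d : Fin n → A⟦X⟧},
    IsRTT T → (∀ i j, coeff 0 (T i j) = if i = j then 1 else 0) → IsGaussFactorization T F d E →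
    ∀ i j r s, Commute (coeff r (d i)) (coeff s (d j)) := by
  induction n with
  | zero => exact fun _ _ _ i => i.elim0
  | succ n ih =>
    intro T F E d H h0 h i j r s
    obtain ⟨u, hu⟩ := exists_unit_apply_zero h0
    obtain ⟨hd, hs⟩ := h.schur hu
    obtain ⟨hR, hc⟩ := H.schur h0 hu
    have key : ∀ (i : Fin n) r s, Commute (coeff r (d 0)) (coeff s (d i.succ)) := fun i r s => by
      refine (commute_C_iff _ _).mp (commute_gauss (coeff_zero_schur u h0) hs (fun i j => ?_) i) s
      rw [commute_C_iff, hd]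
      exact hc i j r
    cases i using Fin.cases with
    | zero =>
      cases j using Fin.cases with
      | zero => rw [hd]; exact H.commute_apply_self 0 r s
      | succ j => exact key j r s
    | succ i =>
      cases j using Fin.cases with
      | zero => exact (key i s r).symm
      | succ j => exact ih hR (coeff_zero_schur u h0) hs i j r s

end Gauss

/-! ### Solutions of the RTT relation that are products of linear factors. -/

section LinearFactors

variable {A : Type*} [Ring A] {n : ℕ}

/-- The matrix of power series `(1 + e 0 u^{-1}) (1 + e 1 u^{-1}) ⋯ (1 + e (L - 1) u^{-1})`. -/
noncomputable def linProd (e : ℕ → Matrix (Fin n) (Fin n) A) : ℕ → Matrix (Fin n) (Fin n) A⟦X⟧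
  | 0 => 1
  | L + 1 => linProd e L * (1 + Matrix.of fun i j => X * C (e L i j))

variable (e : ℕ → Matrix (Fin n) (Fin n) A)

theorem coeff_linProd_zero (r : ℕ) (i j : Fin n) :
    coeff r (linProd e 0 i j) = if r = 0 ∧ i = j then 1 else 0 := by
  simp only [linProd, Matrix.one_apply]
  split_ifs <;> simp_all [coeff_one]

theorem coeff_zero_linProd (L : ℕ) (i j : Fin n) :
    coeff 0 (linProd e L i j) = if i = j then 1 else 0 := by
  induction L with
  | zero => simp [coeff_linProd_zero]
  | succ L ih =>
    rw [linProd, mul_add, mul_one, Matrix.add_apply, map_add, ih, Matrix.mul_apply, map_sum,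
      Finset.sum_eq_zero, add_zero]
    intro k _
    rw [Matrix.of_apply, ← mul_assoc, (commute_X _).eq, mul_assoc, coeff_zero_X_mul]

theorem coeff_succ_linProd_succ (L r : ℕ) (i j : Fin n) :
    coeff (r + 1) (linProd e (L + 1) i j) =
      coeff (r + 1) (linProd e L i j) + ∑ k, coeff r (linProd e L i k) * e L k j := by
  rw [linProd, mul_add, mul_one, Matrix.add_apply, map_add, Matrix.mul_apply, map_sum]
  congr 1
  refine Finset.sum_congr rfl fun k _ => ?_
  rw [Matrix.of_apply, ← mul_assoc, (commute_X _).eq, mul_assoc, coeff_succ_X_mul, coeff_mul_C]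

theorem coeff_linearFactor (x : Matrix (Fin n) (Fin n) A) (r : ℕ) (i j : Fin n) :
    coeff r ((1 + Matrix.of fun i j => X * C (x i j) : Matrix (Fin n) (Fin n) A⟦X⟧) i j) =
      if r = 0 then (if i = j then 1 else 0) else if r = 1 then x i j else 0 := by
  rcases r with _ | _ | r
  · simp only [Matrix.add_apply, Matrix.of_apply, map_add, coeff_zero_X_mul, Matrix.one_apply]
    split_ifs <;> simp
  · simp only [Matrix.add_apply, Matrix.of_apply, map_add, coeff_succ_X_mul, Matrix.one_apply]
    split_ifs <;> simp_all [coeff_one]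
  · simp only [Matrix.add_apply, Matrix.of_apply, map_add, coeff_succ_X_mul, Matrix.one_apply]
    split_ifs <;> simp_all [coeff_one]

/-- This is the evaluation homomorphism: for `1 + x u^{-1}` the RTT relation reduces to the `gl_n`
relations for `x`. -/
theorem isRTT_linearFactor {x : Matrix (Fin n) (Fin n) A}
    (hx : ∀ i j h k, x i j * x h k - x h k * x i j =
      (if h = j then x i k else 0) - if i = k then x h j else 0) :
    IsRTT (1 + Matrix.of fun i j => X * C (x i j) : Matrix (Fin n) (Fin n) A⟦X⟧) := by
  rw [isRTT_iff (fun i j => by rw [coeff_linearFactor]; simp)]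
  intro i j h k r s
  simp only [coeff_linearFactor, Ring.lie_def]
  have := hx i j h k
  rcases r with _ | _ | r <;> rcases s with _ | _ | s <;>
    simp only [Nat.add_eq_zero_iff, and_false, if_false, if_true, one_ne_zero, zero_add,
      add_eq_right, Nat.zero_ne_one, mul_zero, zero_mul, sub_self, mul_ite, ite_mul, mul_one,
      one_mul, this] <;>
    split_ifs <;> simp_all

theorem commute_linProd {L : ℕ} {c : A} (hc : ∀ l < L, ∀ i j, Commute c (e l i j)) (r : ℕ)
    (i j : Fin n) : Commute c (coeff r (linProd e L i j)) := by
  induction L generalizing r i j with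
  | zero => rw [coeff_linProd_zero]; split_ifs <;> simp
  | succ L ih =>
    have ih := fun r i j => ih (fun l hl => hc l (hl.trans L.lt_succ_self)) r i j
    rcases r with _ | r
    · rw [coeff_zero_linProd]; split_ifs <;> simp
    · rw [coeff_succ_linProd_succ]
      exact (ih _ _ _).add_right
        (Commute.sum_right _ _ _ fun k _ => (ih _ _ _).mul_right (hc L L.lt_succ_self _ _))

theorem commute_map_C {f g : A⟦X⟧} (h : ∀ r s, Commute (coeff r f) (coeff s g)) :
    Commute (PowerSeries.map C f) (C g) := by
  ext r s
  rw [coeff_coeff_map_mul_C, coeff_coeff_C_mul_map, (h r s).eq]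

theorem isRTT_linProd (hx : ∀ l i j h k, e l i j * e l h k - e l h k * e l i j =
      (if h = j then e l i k else 0) - if i = k then e l h j else 0)
    (hc : ∀ l m, l ≠ m → ∀ i j h k, Commute (e l i j) (e m h k)) (L : ℕ) :
    IsRTT (linProd e L) := by
  induction L with
  | zero =>
    rw [isRTT_iff (coeff_zero_linProd e 0)]
    intro i j h k r s
    have hc : ∀ r s i j h k, Commute (coeff r (linProd e 0 i j)) (coeff s (linProd e 0 h k)) :=
      fun r s i j h k => by rw [coeff_linProd_zero]; split_ifs <;> simp
    rw [(hc _ _ _ _ _ _).lie_eq, (hc _ _ _ _ _ _).lie_eq]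
    simp only [coeff_linProd_zero]
    by_cases hr : r = 0 <;> by_cases hs : s = 0 <;> simp [hr, hs]
  | succ L ih =>
    have key : ∀ r s i j h k, Commute (coeff r ((1 + Matrix.of fun i j => X * C (e L i j) :
        Matrix (Fin n) (Fin n) A⟦X⟧) i j)) (coeff s (linProd e L h k)) := fun r s i j h k => by
      rw [coeff_linearFactor]
      have := commute_linProd e (fun l hl => hc L l hl.ne' i j) s h k
      split_ifs <;> simp [this]
    have := RTTRel.mul commute_C_X_sub_X commute_C_X_mul_X ih (isRTT_linearFactor (hx L))
      (fun i j h k => commute_map_C fun r s => key r s i j h k)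
      (fun i j h k => (commute_map_C fun r s => (key s r i j h k).symm).symm)
    rw [IsRTT, linProd, Matrix.map_mul, Matrix.map_mul]
    exact this

theorem map_coeff_linProd {B : Type*} [Ring B] (φ : A →+* B) (L r : ℕ) (i j : Fin n) :
    φ (coeff r (linProd e L i j)) = coeff r (linProd (fun l => (e l).map φ) L i j) := by
  induction L generalizing r i j with
  | zero => simp only [coeff_linProd_zero]; split_ifs <;> simp
  | succ L ih =>
    rcases r with _ | r
    · simp only [coeff_zero_linProd]; split_ifs <;> simp
    · simp only [coeff_succ_linProd_succ, map_add, map_sum, map_mul, ih, Matrix.map_apply]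

theorem coeff_linProd_eq (L r : ℕ) (i j : Fin n) :
    coeff r (linProd e L i j) =
      (coeff r ((List.range L).map fun l => 1 + X * C (e l)).prod : Matrix _ _ A) i j := by
  induction L generalizing r i j with
  | zero =>
    rw [coeff_linProd_zero]
    simp only [List.range_zero, List.map_nil, List.prod_nil, coeff_one]
    split_ifs <;> simp_all [Matrix.one_apply]
  | succ L ih =>
    rw [List.range_succ, List.map_append, List.prod_append, List.map_singleton,
      List.prod_singleton, mul_add, mul_one, ← mul_assoc, (commute_X _).eq, mul_assoc, map_add,
      Matrix.add_apply, ← ih]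
    rcases r with _ | r
    · simp only [coeff_zero_linProd, coeff_zero_X_mul, Matrix.zero_apply, add_zero]
    · rw [coeff_succ_linProd_succ, coeff_succ_X_mul, coeff_mul_C, Matrix.mul_apply]
      simp only [ih]

end LinearFactors

/-! ### Approximating complex matrix power series by products of linear factors. -/

section Factorization

variable {n : ℕ}

local notation "Mat" => Matrix (Fin n) (Fin n) ℂ

/-- All positive powers of `a` equal `a`, so substituting `a X` into the factorization of `1 + c
t^{r+1}` into complex linear factors gives the claim. -/
theorem exists_linear_factors_of_idempotent {A : Type*} [Ring A] [Algebra ℂ A] {a : A}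
    (ha : a * a = a) (c : ℂ) (r : ℕ) :
    ∃ l : List A, (l.map fun b => 1 + X * C b).prod = 1 + X ^ (r + 1) * C (c • a) := by
  obtain ⟨η, hη⟩ := IsAlgClosed.exists_pow_nat_eq (-c) r.succ_pos
  have h := (Complex.isPrimitiveRoot_exp (r + 1) r.succ_ne_zero).map_of_injective
    (f := (Polynomial.C : ℂ →+* Polynomial ℂ)) Polynomial.C_injective
  have h1 := h.pow_sub_pow_eq_prod_sub_mul 1 (Polynomial.C η * Polynomial.X) r.succ_pos
  -- The factorization takes place in `ℂ[t]`, so its roots of unity are a priori polynomials; being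
  -- units they are constants.
  have h3 : ∀ ζ : Polynomial ℂ, ∃ c,
      ζ ∈ Polynomial.nthRootsFinset (r + 1) 1 → ζ = Polynomial.C c := by
    intro ζ
    by_cases hζ : ζ ∈ Polynomial.nthRootsFinset (r + 1) 1
    · rw [Polynomial.mem_nthRootsFinset r.succ_pos] at hζ
      obtain ⟨c, _, hc⟩ := Polynomial.isUnit_iff.mp (IsUnit.of_pow_eq_one hζ r.succ_ne_zero)
      exact ⟨c, fun _ => hc.symm⟩
    · exact ⟨0, fun h => absurd h hζ⟩
  choose z hz using h3
  rw [← Finset.prod_map_toList] at h1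
  have h2 := congrArg (Polynomial.aeval (X * C a : A⟦X⟧)) h1
  have ha' : ∀ r, a ^ (r + 1) = a := fun r => by
    induction r with
    | zero => simp
    | succ r ih => rw [pow_succ, ih, ha]
  have hC : ∀ (t : ℂ) (b : A), t • C b = (C (t • b) : A⟦X⟧) := fun t b => by
    ext m; simp [coeff_C]
  refine ⟨(Polynomial.nthRootsFinset (r + 1) (1 : Polynomial ℂ)).toList.map
    fun ζ => -(z ζ * η) • a, ?_⟩
  rw [map_list_prod, List.map_map] at h2
  rw [List.map_map]
  refine (congrArg List.prod (List.map_congr_left fun ζ hζ => ?_)).trans (h2.symm.trans ?_)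
  · have := hz ζ (Finset.mem_toList.mp hζ)
    simp only [Function.comp_apply, map_sub, map_one, map_mul, Polynomial.aeval_C,
      Polynomial.aeval_X]
    conv_rhs => rw [this]
    rw [Polynomial.aeval_C, ← Algebra.smul_def, ← Algebra.smul_def, smul_smul, ← hC,
      mul_smul_comm, neg_smul, ← sub_eq_add_neg]
  · simp only [map_sub, map_one, map_pow, map_mul, Polynomial.aeval_C, Polynomial.aeval_X, one_pow]
    rw [← Algebra.smul_def, smul_pow, hη, (commute_X (C a)).symm.mul_pow, ← map_pow, ha', ← hC,
      mul_smul_comm, neg_smul, sub_neg_eq_add]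

variable (n) in
/-- The matrices `a` such that some product of factors `1 + b X` has the form `1 + a X ^ (r + 1)`
up to higher order terms. -/
def leadingTerms (r : ℕ) : AddSubmonoid Mat where
  carrier := {a | ∃ (l : List Mat) (q : Mat⟦X⟧),
    (l.map fun b => 1 + X * C b).prod = 1 + X ^ (r + 1) * (C a + X * q)}
  zero_mem' := ⟨[], 0, by simp⟩
  add_mem' := by
    rintro a b ⟨l, q, h⟩ ⟨l', q', h'⟩
    -- The leading terms add; the cross term has order `2(r + 1) > r + 1` and joins the remainder.
    refine ⟨l ++ l', q + q' + X ^ r * (C a + X * q) * (C b + X * q'), ?_⟩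
    rw [List.map_append, List.prod_append, h, h', map_add]
    have e : X ^ (r + 1) * (C a + X * q) * (X ^ (r + 1) * (C b + X * q')) =
        X ^ (r + 1) * (X * (X ^ r * (C a + X * q) * (C b + X * q'))) := by
      rw [← mul_assoc (X ^ (r + 1) * (C a + X * q)), mul_assoc (X ^ (r + 1)),
        (commute_X_pow _ (r + 1)).eq, ← mul_assoc X, ← mul_assoc X, ← pow_succ']
      simp only [mul_assoc]
    have e' : ∀ y z : Mat⟦X⟧, (1 + y) * (1 + z) = 1 + y + z + y * z := fun y z => by noncomm_ring
    rw [e', e]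
    noncomm_ring

theorem mem_leadingTerms (r : ℕ) (a : Mat) : a ∈ leadingTerms n r := by
  have hid : ∀ (a : Mat) (c : ℂ), a * a = a → c • a ∈ leadingTerms n r := fun a c ha => by
    obtain ⟨l, hl⟩ := exists_linear_factors_of_idempotent ha c r
    exact ⟨l, 0, by rw [hl, mul_zero, add_zero]⟩
  rw [Matrix.matrix_eq_sum_single a]
  refine AddSubmonoid.sum_mem _ fun i _ => AddSubmonoid.sum_mem _ fun j _ => ?_
  -- Scalar multiples of idempotents span all matrices: off the diagonal, `E_{ij} = (E_{ii} +
  -- E_{ij}) - E_{ii}` is a difference of idempotents.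
  by_cases hij : i = j
  · subst hij
    convert hid (Matrix.single i i 1) (a i i) (by simp) using 1
    simp
  · convert add_mem (hid (Matrix.single i i 1 + Matrix.single i j 1) (a i j)
      (by simp [mul_add, add_mul, Ne.symm hij]))
      (hid (Matrix.single i i 1) (-a i j) (by simp)) using 1
    simp

theorem exists_linear_factors (N : ℕ) (g : Mat⟦X⟧) (hg : constantCoeff g = 1) :
    ∃ (l : List Mat) (q : Mat⟦X⟧), (l.map fun b => 1 + X * C b).prod = g + X ^ (N + 1) * q := by
  induction N with
  | zero =>
    obtain ⟨q, hq⟩ := X_dvd_iff.mpr (show constantCoeff (1 - g) = 0 by simp [hg])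
    exact ⟨[], q, by simp [← hq]⟩
  | succ N ih =>
    obtain ⟨l, q, h⟩ := ih
    -- Since `g` has constant term `1`, this extra product cancels the coefficient of `X ^ (N + 1)`
    -- in the error.
    obtain ⟨l', q', h'⟩ := mem_leadingTerms N (-constantCoeff q)
    obtain ⟨t, ht⟩ := X_dvd_iff.mpr (show constantCoeff
      (q + (g + X ^ (N + 1) * q) * (C (-constantCoeff q) + X * q')) = 0 by simp [hg])
    refine ⟨l ++ l', t, ?_⟩
    rw [List.map_append, List.prod_append, h, h', pow_succ _ (N + 1), mul_assoc _ X t, ← ht,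
      mul_add, mul_one, ← mul_assoc _ (X ^ (N + 1)), (commute_X_pow _ (N + 1)).eq, mul_assoc,
      mul_add _ q]
    abel

/-- Every matrix of coefficients occurs, up to a given order, as the matrix of coefficients of a
product of factors `1 + M u^{-1}`. -/
theorem exists_coeff_linProd_eq (N : ℕ) (c : Fin n × Fin n × ℕ → ℂ) :
    ∃ (L : ℕ) (M : ℕ → Mat), ∀ i j r, r < N → coeff (r + 1) (linProd M L i j) = c (i, j, r) := by
  obtain ⟨l, q, h⟩ := exists_linear_factors N
    (1 + X * PowerSeries.mk fun r => Matrix.of fun i j => c (i, j, r) : Mat⟦X⟧) (by simp)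
  refine ⟨l.length, fun a => l.getD a 0, fun i j r hr => ?_⟩
  have e : (List.range l.length).map (fun a => 1 + X * C (l.getD a 0)) =
      l.map fun b => (1 + X * C b : Mat⟦X⟧) := by
    refine List.ext_getElem (by simp) fun k h1 h2 => ?_
    simp at h1
    simp [h1]
  rw [coeff_linProd_eq, e, h, map_add, map_add, coeff_succ_X_mul, coeff_X_pow_mul', if_neg (by lia)]
  simp [coeff_one]

end Factorization

/-! ### The universal property of the Yangian. -/

namespace Yangian

variable {n : ℕ}

theorem T_zero (i j : Fin n) : T n i j 0 = if i = j then 1 else 0 := by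
  simp only [T, freeT]; split_ifs <;> simp

theorem T_rel (i j h k : Fin n) (r s : ℕ) :
    ⁅T n i j (r + 1), T n h k s⁆ - ⁅T n i j r, T n h k (s + 1)⁆ =
      T n h j r * T n i k s - T n h j s * T n i k r := by
  have := RingQuot.mkAlgHom_rel ℂ (Rel.rtt (n := n) i j h k r s)
  simpa only [T, Ring.lie_def, map_sub, map_mul] using this

theorem coeff_zero_TMatrix (i j : Fin n) :
    coeff 0 (TMatrix n i j) = if i = j then 1 else 0 := by
  simp only [TMatrix, Matrix.of_apply, coeff_mk, T_zero]

theorem isRTT_TMatrix : IsRTT (TMatrix n) := by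
  rw [isRTT_iff coeff_zero_TMatrix]
  simpa only [TMatrix, Matrix.of_apply, coeff_mk] using T_rel

/-- The homomorphism from the Yangian given by a solution of the RTT relation. -/
theorem exists_algHom {B : Type*} [Ring B] [Algebra ℂ B] {S : Matrix (Fin n) (Fin n) B⟦X⟧}
    (h0 : ∀ i j, coeff 0 (S i j) = if i = j then 1 else 0) (hS : IsRTT S) :
    ∃ φ : Yangian n →ₐ[ℂ] B, ∀ i j r, φ (T n i j r) = coeff r (S i j) := by
  rw [isRTT_iff h0] at hS
  let ψ : FreeAlgebra ℂ (Fin n × Fin n × ℕ) →ₐ[ℂ] B :=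
    FreeAlgebra.lift ℂ fun x => coeff (x.2.2 + 1) (S x.1 x.2.1)
  have hψ : ∀ i j r, ψ (freeT n i j r) = coeff r (S i j) := fun i j r => by
    rcases r with _ | r
    · rw [h0, freeT]; split_ifs <;> simp
    · simp [freeT, ψ]
  refine ⟨RingQuot.liftAlgHom ℂ ⟨ψ, ?_⟩, fun i j r => ?_⟩
  · rintro _ _ ⟨i, j, h, k, r, s⟩
    simpa only [Ring.lie_def, map_sub, map_mul, hψ] using hS i j h k r s
  · rw [T, RingQuot.liftAlgHom_mkAlgHom_apply, hψ]

end Yangian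

/-! ### Symbols of operators on polynomial rings. -/

section Symbols

variable {σ : Type*}

/-- Polynomials of total degree less than `d`. -/
noncomputable def degreeLT (σ : Type*) (d : ℕ) : Submodule ℂ (MvPolynomial σ ℂ) :=
  MvPolynomial.restrictSupport ℂ {m | m.degree < d}

theorem degreeLT_mono {d e : ℕ} (h : d ≤ e) : degreeLT σ d ≤ degreeLT σ e :=
  MvPolynomial.restrictSupport_mono _ fun _ hm => lt_of_lt_of_le hm h

theorem mul_mem_degreeLT {d e : ℕ} {p q : MvPolynomial σ ℂ} (hp : p ∈ degreeLT σ (d + 1))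
    (hq : q ∈ degreeLT σ e) : p * q ∈ degreeLT σ (d + e) := by
  have h := Submodule.mul_mem_mul hp hq
  rw [degreeLT, degreeLT, ← MvPolynomial.restrictSupport_add] at h
  refine MvPolynomial.restrictSupport_mono _ ?_ h
  rintro _ ⟨a, ha, b, hb, rfl⟩
  simp only [Set.mem_ofPred_eq, map_add] at ha hb ⊢
  lia

theorem one_mem_degreeLT : (1 : MvPolynomial σ ℂ) ∈ degreeLT σ 1 := by
  rw [← MvPolynomial.C_1, MvPolynomial.C_apply, degreeLT, MvPolynomial.monomial_mem_restrictSupport]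
  simp

theorem X_mem_degreeLT (i : σ) : (MvPolynomial.X i : MvPolynomial σ ℂ) ∈ degreeLT σ 2 := by
  rw [MvPolynomial.X, degreeLT, MvPolynomial.monomial_mem_restrictSupport]
  simp

/-- Differentiation removes one variable and `f i` restores at most one degree. -/
theorem derivation_mem_degreeLT {f : σ → MvPolynomial σ ℂ} (hf : ∀ i, f i ∈ degreeLT σ 2) {d : ℕ}
    {p : MvPolynomial σ ℂ} (hp : p ∈ degreeLT σ d) :
    MvPolynomial.mkDerivation ℂ f p ∈ degreeLT σ d := by
  rw [degreeLT, MvPolynomial.restrictSupport_eq_span] at hp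
  induction hp using Submodule.span_induction with
  | mem x hx =>
    obtain ⟨m, hm, rfl⟩ := hx
    rw [MvPolynomial.mkDerivation_monomial, one_smul]
    refine Submodule.sum_mem _ fun i hi => ?_
    have h1 : m - Finsupp.single i 1 + Finsupp.single i 1 = m :=
      tsub_add_cancel_of_le (Finsupp.single_le_iff.mpr
        (Nat.one_le_iff_ne_zero.mpr (Finsupp.mem_support_iff.mp hi)))
    have h2 := congrArg Finsupp.degree h1
    rw [map_add, Finsupp.degree_single] at h2
    have h3 : (MvPolynomial.monomial (m - Finsupp.single i 1) (m i : ℂ)) ∈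
        degreeLT σ ((m - Finsupp.single i 1).degree + 1) := by
      rw [degreeLT, MvPolynomial.monomial_mem_restrictSupport]
      exact Or.inl (Nat.lt_succ_self _)
    dsimp only
    rw [smul_eq_mul, mul_comm]
    refine degreeLT_mono ?_ (mul_mem_degreeLT (hf i) h3)
    have hm' : m.degree < d := hm
    lia
  | zero => simp
  | add x y _ _ hx hy => rw [map_add]; exact add_mem hx hy
  | smul c x _ hx => rw [Derivation.map_smul]; exact Submodule.smul_mem _ _ hx

/-- The operator `O` on polynomials is multiplication by `s`, a polynomial of degree at most `r`,
up to terms that raise the degree by less than `r`. -/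
def HasSymbol (r : ℕ) (O : Module.End ℂ (MvPolynomial σ ℂ)) (s : MvPolynomial σ ℂ) : Prop :=
  s ∈ degreeLT σ (r + 1) ∧
    ∀ d, ∀ g ∈ degreeLT σ (d + 1), O g - s * g ∈ degreeLT σ (r + d)

variable {r r' : ℕ} {O O' : Module.End ℂ (MvPolynomial σ ℂ)} {s s' : MvPolynomial σ ℂ}

theorem HasSymbol.apply_mem (h : HasSymbol r O s) {d : ℕ} {g : MvPolynomial σ ℂ}
    (hg : g ∈ degreeLT σ (d + 1)) : O g ∈ degreeLT σ (r + d + 1) := by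
  rw [← sub_add_cancel (O g) (s * g)]
  exact add_mem (degreeLT_mono (Nat.le_succ _) (h.2 d g hg))
    (by rw [add_assoc]; exact mul_mem_degreeLT h.1 hg)

theorem HasSymbol.mul (h : HasSymbol r O s) (h' : HasSymbol r' O' s') :
    HasSymbol (r + r') (O * O') (s * s') := by
  refine ⟨by rw [add_assoc]; exact mul_mem_degreeLT h.1 h'.1, fun d g hg => ?_⟩
  have e : (O * O') g - s * s' * g = (O (O' g) - s * O' g) + s * (O' g - s' * g) := by
    rw [Module.End.mul_apply]; ring
  rw [e, add_assoc]
  exact add_mem (h.2 _ _ (h'.apply_mem hg)) (mul_mem_degreeLT h.1 (h'.2 _ _ hg))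

theorem HasSymbol.add (h : HasSymbol r O s) (h' : HasSymbol r O' s') :
    HasSymbol r (O + O') (s + s') := by
  refine ⟨add_mem h.1 h'.1, fun d g hg => ?_⟩
  have e : (O + O') g - (s + s') * g = (O g - s * g) + (O' g - s' * g) := by
    rw [LinearMap.add_apply]; ring
  rw [e]
  exact add_mem (h.2 _ _ hg) (h'.2 _ _ hg)

theorem HasSymbol.smul (h : HasSymbol r O s) (c : ℂ) : HasSymbol r (c • O) (c • s) := by
  refine ⟨Submodule.smul_mem _ _ h.1, fun d g hg => ?_⟩
  rw [LinearMap.smul_apply, smul_mul_assoc, ← smul_sub]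
  exact Submodule.smul_mem _ _ (h.2 _ _ hg)

theorem HasSymbol.zero : HasSymbol r (0 : Module.End ℂ (MvPolynomial σ ℂ)) 0 :=
  ⟨zero_mem _, fun d g _ => by simp⟩

theorem HasSymbol.one : HasSymbol 0 (1 : Module.End ℂ (MvPolynomial σ ℂ)) 1 :=
  ⟨one_mem_degreeLT, fun d g _ => by simp⟩

theorem HasSymbol.sum {ι : Type*} (t : Finset ι) {O : ι → Module.End ℂ (MvPolynomial σ ℂ)}
    {s : ι → MvPolynomial σ ℂ} (h : ∀ i ∈ t, HasSymbol r (O i) (s i)) :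
    HasSymbol r (∑ i ∈ t, O i) (∑ i ∈ t, s i) := by
  classical
  induction t using Finset.induction_on with
  | empty => exact HasSymbol.zero
  | insert i t hi ih =>
    rw [Finset.sum_insert hi, Finset.sum_insert hi]
    exact (h i (Finset.mem_insert_self i t)).add
      (ih fun j hj => h j (Finset.mem_insert_of_mem hj))

theorem HasSymbol.zero_of_lt (h : HasSymbol r O s) (hr : r < r') : HasSymbol r' O 0 :=
  ⟨zero_mem _, fun d g hg => by
    rw [zero_mul, sub_zero]; exact degreeLT_mono (by lia) (h.apply_mem hg)⟩

theorem HasSymbol.list_prod {ι : Type*} {w : ι → ℕ} {O : ι → Module.End ℂ (MvPolynomial σ ℂ)}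
    {s : ι → MvPolynomial σ ℂ} (h : ∀ i, HasSymbol (w i) (O i) (s i)) (l : List ι) :
    HasSymbol (l.map w).sum (l.map O).prod (l.map s).prod := by
  induction l with
  | nil => exact HasSymbol.one
  | cons i l ih => simpa using (h i).mul ih

theorem eq_zero_of_isHomogeneous_of_mem_degreeLT {d : ℕ} {p : MvPolynomial σ ℂ}
    (hp : p.IsHomogeneous d) (h : p ∈ degreeLT σ d) : p = 0 := by
  ext m
  by_contra hm
  have h1 : m.degree < d := h (MvPolynomial.mem_support_iff.mpr hm)
  exact hm (hp.coeff_eq_zero h1.ne)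

theorem isHomogeneous_list_prod {ι : Type*} {w : ι → ℕ} {s : ι → MvPolynomial σ ℂ}
    (h : ∀ i, (s i).IsHomogeneous (w i)) (l : List ι) :
    (l.map s).prod.IsHomogeneous (l.map w).sum := by
  induction l with
  | nil => exact MvPolynomial.isHomogeneous_one _ _
  | cons i l ih => simpa using (h i).mul ih

end Symbols

/-! ### Operators realizing `gl_n` whose symbols are free variables. -/

section GeneratingOperators

variable {n : ℕ}

/-- The vector field by which the matrix unit `(i, j)` of the `a`-th copy of `gl_n` acts on
polynomials in the entries of a sequence of matrices. -/
noncomputable def glDer (a : ℕ) (i j : Fin n) : Derivation ℂ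
    (MvPolynomial (ℕ × Fin n × Fin n) ℂ) (MvPolynomial (ℕ × Fin n × Fin n) ℂ) :=
  MvPolynomial.mkDerivation ℂ fun x : ℕ × Fin n × Fin n =>
    if x.1 = a ∧ x.2.1 = j then MvPolynomial.X (a, i, x.2.2) else 0

theorem glDer_X (a : ℕ) (i j : Fin n) (x : ℕ × Fin n × Fin n) : glDer a i j (MvPolynomial.X x) =
    if x.1 = a ∧ x.2.1 = j then MvPolynomial.X (a, i, x.2.2) else 0 :=
  MvPolynomial.mkDerivation_X _ _ _

theorem glDer_lie (a b : ℕ) (i j h k : Fin n) :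
    ⁅glDer a i j, glDer b h k⁆ = if a = b then
      (if h = j then glDer a i k else 0) - (if i = k then glDer a h j else 0) else 0 := by
  refine MvPolynomial.derivation_ext fun x => ?_
  rw [Derivation.commutator_apply, glDer_X, glDer_X]
  by_cases hab : a = b
  · subst hab
    by_cases h1 : h = j <;> by_cases h2 : i = k <;> by_cases h3 : x.1 = a <;>
      by_cases h4 : x.2.1 = j <;> by_cases h5 : x.2.1 = k <;>
      simp [h1, h2, h3, h4, h5, glDer_X] <;> simp_all [glDer_X]
  · by_cases h3 : x.1 = a <;> by_cases h4 : x.1 = b <;>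
      simp [h3, h4, hab, Ne.symm hab] <;> split_ifs <;>
      simp [glDer_X, hab, Ne.symm hab]

/-- The action of the matrix unit `(i, j)` of the `a`-th copy of `gl_n` on polynomials in the
entries of a sequence of matrices, twisted by multiplication by the entry itself. -/
noncomputable def glOp (a : ℕ) : Matrix (Fin n) (Fin n)
    (Module.End ℂ (MvPolynomial (ℕ × Fin n × Fin n) ℂ)) :=
  Matrix.of fun i j => LinearMap.mulLeft ℂ (MvPolynomial.X (a, i, j)) + (glDer a i j).toLinearMap

theorem hasSymbol_glOp (a : ℕ) (i j : Fin n) :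
    HasSymbol 1 (glOp a i j) (MvPolynomial.X (a, i, j)) := by
  refine ⟨X_mem_degreeLT _, fun d g hg => ?_⟩
  rw [glOp, Matrix.of_apply, LinearMap.add_apply, LinearMap.mulLeft_apply, add_sub_cancel_left,
    add_comm 1 d]
  refine derivation_mem_degreeLT (fun x => ?_) hg
  split_ifs
  · exact X_mem_degreeLT _
  · exact zero_mem _

theorem mulLeft_add_derivation_commutator {R A : Type*} [CommRing R] [CommRing A] [Algebra R A]
    (f g : A) (D E : Derivation R A A) :
    (LinearMap.mulLeft R f + D.toLinearMap) * (LinearMap.mulLeft R g + E.toLinearMap) -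
      (LinearMap.mulLeft R g + E.toLinearMap) * (LinearMap.mulLeft R f + D.toLinearMap) =
      LinearMap.mulLeft R (D g - E f) + (⁅D, E⁆ : Derivation R A A).toLinearMap := by
  ext x
  simp [Ring.lie_def]
  ring

/-- Multiplications and vector fields satisfy the same bracket relations: the vector field of `(i,
j)` sends `x_{h,k}` to `δ_{h,j} x_{i,k}`, so the mixed terms supply exactly the multiplication part
of the bracket. -/
theorem glOp_commutator (a b : ℕ) (i j h k : Fin n) :
    glOp a i j * glOp b h k - glOp b h k * glOp a i j =
      if a = b then
        (if h = j then glOp a i k else 0) - (if i = k then glOp a h j else 0) else 0 := by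
  simp only [glOp, Matrix.of_apply]
  rw [mulLeft_add_derivation_commutator]
  simp only [glDer_X, glDer_lie]
  by_cases hab : a = b
  · subst hab
    refine LinearMap.ext fun x => ?_
    by_cases h1 : h = j <;> by_cases h2 : i = k <;> simp [h1, h2] <;> ring
  · simp [hab, Ne.symm hab]

theorem isRTT_glOp (L : ℕ) : IsRTT (linProd (glOp (n := n)) L) := by
  refine isRTT_linProd _ (fun l i j h k => ?_) (fun l m hlm i j h k => ?_) L
  · rw [glOp_commutator, if_pos rfl]
  · have := glOp_commutator l m i j h k
    rw [if_neg hlm] at this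
    exact sub_eq_zero.mp this

/-- The generic matrices whose entries are variables. -/
noncomputable def genericMatrix (a : ℕ) :
    Matrix (Fin n) (Fin n) (MvPolynomial (ℕ × Fin n × Fin n) ℂ) :=
  Matrix.of fun i j => MvPolynomial.X (a, i, j)

/-- Operators and symbols obey the same recursion in `L`, and the factor `glOp L` contributes order
`1`. -/
theorem hasSymbol_coeff_linProd (L r : ℕ) (i j : Fin n) :
    HasSymbol r (coeff r (linProd glOp L i j)) (coeff r (linProd genericMatrix L i j)) := by
  have h0 : ∀ L i j, HasSymbol 0 (coeff 0 (linProd (glOp (n := n)) L i j))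
      (coeff 0 (linProd genericMatrix L i j)) := by
    intro L i j
    simp only [coeff_zero_linProd]
    split_ifs
    exacts [HasSymbol.one, HasSymbol.zero]
  induction L generalizing r i j with
  | zero =>
    rcases r with _ | r
    · exact h0 0 i j
    · simpa only [coeff_linProd_zero, Nat.succ_ne_zero, false_and, if_false] using HasSymbol.zero
  | succ L ih =>
    rcases r with _ | r
    · exact h0 (L + 1) i j
    · rw [coeff_succ_linProd_succ, coeff_succ_linProd_succ]
      exact (ih _ _ _).add (HasSymbol.sum _ fun k _ => (ih _ _ _).mul (hasSymbol_glOp L k j))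

theorem isHomogeneous_coeff_linProd (L r : ℕ) (i j : Fin n) :
    (coeff r (linProd genericMatrix L i j)).IsHomogeneous r := by
  have h0 : ∀ L (i j : Fin n), (coeff 0 (linProd genericMatrix L i j)).IsHomogeneous 0 := by
    intro L i j
    simp only [coeff_zero_linProd]
    split_ifs
    exacts [MvPolynomial.isHomogeneous_one _ _, MvPolynomial.isHomogeneous_zero _ _ _]
  induction L generalizing r i j with
  | zero =>
    rcases r with _ | r
    · exact h0 0 i j
    · simpa only [coeff_linProd_zero, Nat.succ_ne_zero, false_and, if_false] using
        MvPolynomial.isHomogeneous_zero _ _ _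
  | succ L ih =>
    rcases r with _ | r
    · exact h0 (L + 1) i j
    · rw [coeff_succ_linProd_succ]
      exact (ih _ _ _).add (MvPolynomial.IsHomogeneous.sum _ _ _ fun k _ =>
        (ih _ _ _).mul (MvPolynomial.isHomogeneous_X _ _))

end GeneratingOperators

/-! ### Linear independence of ordered monomials. -/

namespace Yangian

variable {n : ℕ}

/-- The generators `T_{i,j}^{(r + 1)}` of the Yangian. -/
noncomputable def gen (x : Fin n × Fin n × ℕ) : Yangian n := T n x.1 x.2.1 (x.2.2 + 1)

/-- The product of the generators with given multiplicities, in an arbitrary order. -/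
noncomputable def genMonomial (m : Fin n × Fin n × ℕ →₀ ℕ) : Yangian n :=
  (m.toMultiset.toList.map gen).prod

/-- The linear map from polynomials to the Yangian that sends a monomial to the product of the
corresponding generators in an arbitrary order. -/
noncomputable def orderedEval (n : ℕ) : MvPolynomial (Fin n × Fin n × ℕ) ℂ →ₗ[ℂ] Yangian n :=
  (MvPolynomial.basisMonomials _ ℂ).constr ℂ genMonomial

theorem orderedEval_monomial (m : Fin n × Fin n × ℕ →₀ ℕ) (c : ℂ) :
    orderedEval n (MvPolynomial.monomial m c) = c • genMonomial m := by
  have := (MvPolynomial.basisMonomials (Fin n × Fin n × ℕ) ℂ).constr_basis ℂ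
    (genMonomial (n := n)) m
  rw [MvPolynomial.coe_basisMonomials] at this
  rw [orderedEval, ← this, ← map_smul, MvPolynomial.smul_monomial, smul_eq_mul, mul_one]

theorem list_prod_map_toList_toMultiset {ι A : Type*} [CommMonoid A] (f : ι → A) (m : ι →₀ ℕ) :
    (m.toMultiset.toList.map f).prod = m.prod fun i k => f i ^ k := by
  rw [← Multiset.prod_coe, ← Multiset.map_coe, Multiset.coe_toList, Finsupp.toMultiset_map,
    Finsupp.prod_toMultiset, Finsupp.prod_mapDomain_index pow_zero pow_add]

theorem list_sum_map_toList_toMultiset {ι A : Type*} [AddCommMonoid A] (f : ι → A) (m : ι →₀ ℕ) :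
    (m.toMultiset.toList.map f).sum = Finsupp.weight f m := by
  rw [← Multiset.sum_coe, ← Multiset.map_coe, Multiset.coe_toList]
  induction m using Finsupp.induction_linear with
  | zero => simp
  | add x y hx hy => rw [map_add, map_add, Multiset.map_add, Multiset.sum_add, hx, hy]
  | single i k => simp [Finsupp.weight_single, Multiset.map_nsmul, Multiset.sum_nsmul]


/-- The monomials in the generators of the Yangian, each taken in an arbitrary order, are linearly
independent. -/
theorem orderedEval_injective : Function.Injective (orderedEval n) := by
  classical
  rw [← LinearMap.ker_eq_bot, LinearMap.ker_eq_bot']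
  intro p hp
  by_contra hp0
  -- Here `T^{(r)}` has weight `r`, the order of its symbol. This is not the lexicographic weight
  -- used later for leading terms.
  set wt : Fin n × Fin n × ℕ → ℕ := fun x => x.2.2 + 1
  obtain ⟨m₀, hm₀, hmax⟩ := p.support.exists_max_image (Finsupp.weight wt)
    (MvPolynomial.support_nonempty.mpr hp0)
  set W := Finsupp.weight wt m₀
  -- Only the top weight component contributes to the symbol of order `W`; all other monomials act
  -- with smaller order.
  set f := MvPolynomial.weightedHomogeneousComponent wt W p with hf
  have hfc : f.coeff m₀ = p.coeff m₀ := by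
    rw [hf, MvPolynomial.coeff_weightedHomogeneousComponent, if_pos rfl]
  have hvanish : ∀ L, MvPolynomial.aeval (fun x : Fin n × Fin n × ℕ =>
      coeff (x.2.2 + 1) (linProd genericMatrix L x.1 x.2.1)) f = 0 := by
    intro L
    obtain ⟨ρ, hρ⟩ := exists_algHom (coeff_zero_linProd (glOp (n := n)) L) (isRTT_glOp L)
    set τ := fun x : Fin n × Fin n × ℕ => coeff (x.2.2 + 1) (linProd genericMatrix L x.1 x.2.1)
    have hmon : ∀ m, HasSymbol (Finsupp.weight wt m) (ρ (genMonomial m))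
        (MvPolynomial.aeval τ (MvPolynomial.monomial m (1 : ℂ))) := fun m => by
      rw [MvPolynomial.aeval_monomial, map_one, one_mul, ← list_prod_map_toList_toMultiset,
        genMonomial, map_list_prod, List.map_map, ← list_sum_map_toList_toMultiset]
      refine HasSymbol.list_prod (fun x => ?_) _
      rw [Function.comp_apply, gen, hρ]
      exact hasSymbol_coeff_linProd L _ _ _
    have hsym : HasSymbol W (ρ (orderedEval n p)) (MvPolynomial.aeval τ f) := by
      rw [hf, MvPolynomial.weightedHomogeneousComponent_apply, Finset.sum_filter, map_sum]
      conv in orderedEval n p => rw [p.as_sum]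
      rw [map_sum, map_sum]
      refine HasSymbol.sum _ fun m hm => ?_
      rw [orderedEval_monomial, map_smul]
      split_ifs with h
      · rw [← mul_one (p.coeff m), ← smul_eq_mul, ← MvPolynomial.smul_monomial, map_smul,
          smul_eq_mul, mul_one, ← h]
        exact (hmon m).smul _
      · rw [map_zero]
        exact ((hmon m).smul _).zero_of_lt (lt_of_le_of_ne (hmax m hm) h)
    have hhom : (MvPolynomial.aeval τ f).IsHomogeneous W := by
      rw [hf, MvPolynomial.weightedHomogeneousComponent_apply, map_sum]
      refine MvPolynomial.IsHomogeneous.sum _ _ _ fun m hm => ?_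
      rw [MvPolynomial.aeval_monomial, ← list_prod_map_toList_toMultiset,
        ← (Finset.mem_filter.mp hm).2, ← list_sum_map_toList_toMultiset]
      rw [← zero_add (List.sum _)]
      exact (MvPolynomial.isHomogeneous_C _ _).mul
        (isHomogeneous_list_prod (fun x => isHomogeneous_coeff_linProd L _ _ _) _)
    refine eq_zero_of_isHomogeneous_of_mem_degreeLT hhom ?_
    -- The zero operator applied to `1` differs from the symbol by terms of degree less than `W`,
    -- whereas the symbol is homogeneous of degree `W`.
    have := hsym.2 0 1 one_mem_degreeLT
    rwa [hp, map_zero, LinearMap.zero_apply, mul_one, zero_sub, neg_mem_iff] at this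
  have hf0 : f = 0 := by
    refine MvPolynomial.funext fun c => ?_
    -- Specializing the generic matrices to `M` turns the vanishing symbol into the value of `f` at
    -- `c`; the bound covers every variable of `f`.
    obtain ⟨L, M, hM⟩ := exists_coeff_linProd_eq (f.vars.sup (fun x => x.2.2) + 1) c
    have h := congrArg (MvPolynomial.aeval fun y : ℕ × Fin n × Fin n => M y.1 y.2.1 y.2.2)
      (hvanish L)
    rw [MvPolynomial.comp_aeval_apply, map_zero] at h
    rw [map_zero, ← h, ← MvPolynomial.coe_aeval_eq_eval, RingHom.coe_coe]
    refine MvPolynomial.eval₂Hom_congr' rfl (fun x hx _ => ?_) rfl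
    rw [← hM _ _ _ (Nat.lt_succ_of_le (Finset.le_sup (f := fun x => x.2.2) hx)),
      ← AlgHom.coe_toRingHom, map_coeff_linProd]
    congr 3
    ext l i j
    simp [genericMatrix]
  exact MvPolynomial.mem_support_iff.mp hm₀ (by rw [← hfc, hf0, MvPolynomial.coeff_zero])

end Yangian

/-! ### Comparison of the diagonal Gauss factors with the diagonal entries of `T`. -/

section GaussFiltration

variable {A : Type*} [Ring A] [Algebra ℂ A]

/-- An increasing filtration of an algebra; the index is one more than the filtration degree. -/
structure IsShiftedFiltration (G : ℕ → Submodule ℂ A) : Prop where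
  zero : G 0 = ⊥
  mono : Monotone G
  one_mem : 1 ∈ G 1
  mul_mem : ∀ {a b x y}, x ∈ G (a + 1) → y ∈ G (b + 1) → x * y ∈ G (a + b + 1)

variable {G : ℕ → Submodule ℂ A}

theorem IsShiftedFiltration.coeff_mul_mem_left (hG : IsShiftedFiltration G)
    {f g : A⟦X⟧} (hf : ∀ r, coeff r f ∈ G r)
    (hg : ∀ r, coeff r g ∈ G (r + 1)) (r : ℕ) : coeff r (f * g) ∈ G r := by
  rw [coeff_mul]
  refine Submodule.sum_mem _ fun ⟨a, b⟩ hab => ?_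
  rw [Finset.HasAntidiagonal.mem_antidiagonal] at hab
  rcases a with _ | a
  · have := hf 0
    rw [hG.zero, Submodule.mem_bot] at this
    simp [this]
  · rw [← hab, add_right_comm]
    exact hG.mul_mem (hf (a + 1)) (hg b)

/-- Each factor has its coefficient of index `r` in degree at most `r - 1`, so their product gains
one further degree. -/
theorem IsShiftedFiltration.coeff_mul_mem_pred (hG : IsShiftedFiltration G)
    {f g : A⟦X⟧} (hf : ∀ r, coeff r f ∈ G r)
    (hg : ∀ r, coeff r g ∈ G r) (r : ℕ) : coeff r (f * g) ∈ G (r - 1) := by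
  rw [coeff_mul]
  refine Submodule.sum_mem _ fun ⟨a, b⟩ hab => ?_
  rw [Finset.HasAntidiagonal.mem_antidiagonal] at hab
  have hf0 := hf 0
  have hg0 := hg 0
  rw [hG.zero, Submodule.mem_bot] at hf0 hg0
  rcases a with _ | a
  · simp [hf0]
  rcases b with _ | b
  · simp [hg0]
  have : r - 1 = a + b + 1 := by lia
  rw [this]
  exact hG.mul_mem (hf (a + 1)) (hg (b + 1))

theorem IsShiftedFiltration.coeff_one_mem (hG : IsShiftedFiltration G) (r : ℕ) :
    coeff r (1 : A⟦X⟧) ∈ G (r + 1) := by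
  rw [coeff_one]
  split_ifs with h
  · rw [h]; exact hG.one_mem
  · exact zero_mem _

theorem IsShiftedFiltration.coeff_inv_mem (hG : IsShiftedFiltration G) {u : A⟦X⟧ˣ}
    (hu : ∀ r, coeff r ((u : A⟦X⟧) - 1) ∈ G r) (r : ℕ) : coeff r (↑u⁻¹ : A⟦X⟧) ∈ G (r + 1) := by
  induction r using Nat.strong_induction_on with
  | _ r ih =>
    -- This expresses each coefficient of the inverse through earlier ones, as `u - 1` has no
    -- constant term.
    have e : (↑u⁻¹ : A⟦X⟧) = 1 - ((u : A⟦X⟧) - 1) * ↑u⁻¹ := by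
      rw [sub_mul, u.mul_inv, one_mul]; abel
    rw [e, map_sub, coeff_mul]
    refine sub_mem (hG.coeff_one_mem r) (Submodule.sum_mem _ fun ⟨a, b⟩ hab => ?_)
    rw [Finset.HasAntidiagonal.mem_antidiagonal] at hab
    rcases a with _ | a
    · have := hu 0
      rw [hG.zero, Submodule.mem_bot] at this
      rw [this, zero_mul]
      exact zero_mem _
    · refine hG.mono (show a + b + 1 ≤ r + 1 by lia) (hG.mul_mem (hu (a + 1)) (ih b (by lia)))

/-- Each Schur complement changes an entry by a product containing two off-diagonal entries of the
current matrix, which costs one degree. -/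
theorem IsShiftedFiltration.gauss_diag_sub_mem (hG : IsShiftedFiltration G) {n : ℕ} :
    ∀ {T F E : Matrix (Fin n) (Fin n) A⟦X⟧} {d : Fin n → A⟦X⟧},
    (∀ i j, coeff 0 (T i j) = if i = j then 1 else 0) →
    (∀ i j r, coeff r (T i j - if i = j then 1 else 0) ∈ G r) → IsGaussFactorization T F d E →
    ∀ i r, coeff r (d i - T i i) ∈ G (r - 1) := by
  induction n with
  | zero => exact fun _ _ _ i => i.elim0
  | succ n ih =>
    intro T F E d h0 hT h i r
    obtain ⟨u, hu⟩ := exists_unit_apply_zero h0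
    obtain ⟨hd, hs⟩ := h.schur hu
    have hu' : ∀ r, coeff r (↑u⁻¹ : A⟦X⟧) ∈ G (r + 1) := hG.coeff_inv_mem fun r => by
      rw [hu]; simpa using hT 0 0 r
    have hS : ∀ (i j : Fin n) r, coeff r (schurCompl T u i j - T i.succ j.succ) ∈ G (r - 1) := by
      intro i j r
      have e : schurCompl T u i j - T i.succ j.succ =
          -(T i.succ 0 * (↑u⁻¹ : A⟦X⟧) * T 0 j.succ) := by
        rw [schurCompl, Matrix.of_apply]; abel
      rw [e, map_neg, neg_mem_iff]
      refine hG.coeff_mul_mem_pred (hG.coeff_mul_mem_left (fun r => ?_) hu') (fun r => ?_) r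
      · simpa using hT i.succ 0 r
      · simpa [(Fin.succ_ne_zero _).symm] using hT 0 j.succ r
    cases i using Fin.cases with
    | zero => rw [hd]; simp
    | succ i =>
      rw [← sub_add_sub_cancel _ (schurCompl T u i i), map_add]
      refine add_mem (ih (coeff_zero_schur u h0) (fun i j r => ?_) hs i r) (hS i i r)
      rw [← sub_add_sub_cancel _ (T i.succ j.succ), map_add]
      refine add_mem (hG.mono (Nat.sub_le r 1) (hS i j r)) ?_
      simpa using hT i.succ j.succ r

end GaussFiltration

/-! ### The lexicographic filtration, for which the generators commute to leading order. -/

namespace Yangian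

variable {n : ℕ}

/-- The degree of a generator: its degree in the loop filtration, and `1` for the number of
generators, ordered lexicographically. -/
def wt (x : Fin n × Fin n × ℕ) : ℕ ×ₗ ℕ := toLex (x.2.2, 1)

theorem toLex_add_toLex (a b c d : ℕ) :
    (toLex (a, b) + toLex (c, d) : ℕ ×ₗ ℕ) = toLex (a + c, b + d) := rfl

/-- Combinations of products of generators of degree less than `w`. -/
noncomputable def filtLT (n : ℕ) (w : ℕ ×ₗ ℕ) : Submodule ℂ (Yangian n) :=
  Submodule.span ℂ {y | ∃ l : List (Fin n × Fin n × ℕ), (l.map wt).sum < w ∧ y = (l.map gen).prod}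

/-- Combinations of products of generators of degree at most `w`. -/
noncomputable def filtLE (n : ℕ) (w : ℕ ×ₗ ℕ) : Submodule ℂ (Yangian n) :=
  Submodule.span ℂ {y | ∃ l : List (Fin n × Fin n × ℕ), (l.map wt).sum ≤ w ∧ y = (l.map gen).prod}

variable {v w : ℕ ×ₗ ℕ} {x y : Yangian n}

theorem filtLT_mono (h : v ≤ w) : filtLT n v ≤ filtLT n w :=
  Submodule.span_mono fun _ ⟨l, hl, hy⟩ => ⟨l, hl.trans_le h, hy⟩

theorem filtLE_mono (h : v ≤ w) : filtLE n v ≤ filtLE n w :=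
  Submodule.span_mono fun _ ⟨l, hl, hy⟩ => ⟨l, hl.trans h, hy⟩

theorem filtLE_le_filtLT (h : v < w) : filtLE n v ≤ filtLT n w :=
  Submodule.span_mono fun _ ⟨l, hl, hy⟩ => ⟨l, hl.trans_lt h, hy⟩

theorem filtLT_le_filtLE : filtLT n w ≤ filtLE n w :=
  Submodule.span_mono fun _ ⟨l, hl, hy⟩ => ⟨l, hl.le, hy⟩

theorem list_prod_mem_filtLE (l : List (Fin n × Fin n × ℕ)) :
    (l.map gen).prod ∈ filtLE n (l.map wt).sum :=
  Submodule.subset_span ⟨l, le_rfl, rfl⟩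

theorem gen_mem_filtLE (x : Fin n × Fin n × ℕ) : gen x ∈ filtLE n (wt x) := by
  simpa using list_prod_mem_filtLE [x]

theorem mul_mem_filtLE (hx : x ∈ filtLE n v) (hy : y ∈ filtLE n w) : x * y ∈ filtLE n (v + w) := by
  have h := Submodule.mul_mem_mul hx hy
  rw [filtLE, filtLE, Submodule.span_mul_span] at h
  refine Submodule.span_mono ?_ h
  rintro _ ⟨_, ⟨l, hl, rfl⟩, _, ⟨l', hl', rfl⟩, rfl⟩
  exact ⟨l ++ l', by simpa using add_le_add hl hl', by simp⟩

theorem mul_mem_filtLT_left (hx : x ∈ filtLT n v) (hy : y ∈ filtLE n w) :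
    x * y ∈ filtLT n (v + w) := by
  have h := Submodule.mul_mem_mul hx hy
  rw [filtLE, filtLT, Submodule.span_mul_span] at h
  refine Submodule.span_mono ?_ h
  rintro _ ⟨_, ⟨l, hl, rfl⟩, _, ⟨l', hl', rfl⟩, rfl⟩
  exact ⟨l ++ l', by simpa using add_lt_add_of_lt_of_le hl hl', by simp⟩

theorem mul_mem_filtLT_right (hx : x ∈ filtLE n v) (hy : y ∈ filtLT n w) :
    x * y ∈ filtLT n (v + w) := by
  have h := Submodule.mul_mem_mul hx hy
  rw [filtLE, filtLT, Submodule.span_mul_span] at h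
  refine Submodule.span_mono ?_ h
  rintro _ ⟨_, ⟨l, hl, rfl⟩, _, ⟨l', hl', rfl⟩, rfl⟩
  exact ⟨l ++ l', by simpa using add_lt_add_of_le_of_lt hl hl', by simp⟩

theorem T_succ_mem_filtLE (i j : Fin n) (r : ℕ) : T n i j (r + 1) ∈ filtLE n (toLex (r, 1)) :=
  gen_mem_filtLE (i, j, r)

theorem one_mem_filtLE : (1 : Yangian n) ∈ filtLE n 0 := by
  simpa using list_prod_mem_filtLE (n := n) []

/-- The defining relation moves one unit from the first upper index to the second at the cost of
quadratic terms of smaller loop degree; once the first index is `1` the formula is exact. -/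
theorem lie_T_sub_mem (i j h k : Fin n) (r s : ℕ) :
    ⁅T n i j (r + 1), T n h k (s + 1)⁆ - ((if h = j then T n i k (r + s + 1) else 0) -
      (if i = k then T n h j (r + s + 1) else 0)) ∈ filtLT n (toLex (r + s, 0)) := by
  induction r generalizing s with
  | zero =>
    have := T_rel i j h k 0 (s + 1)
    have h1 : ⁅T n i j 0, T n h k (s + 1 + 1)⁆ = 0 := by
      rw [T_zero]; split_ifs <;> simp [Ring.lie_def]
    rw [h1, sub_zero, T_zero, T_zero] at this
    rw [this]
    simp
  | succ r ih =>
    have h1 := T_rel i j h k (r + 1) (s + 1)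
    have h2 := ih (s + 1)
    rw [show r + (s + 1) = r + 1 + s by ring] at h2
    rw [eq_add_of_sub_eq h1, add_sub_assoc]
    have h3 : ∀ i j h k : Fin n, T n i j (r + 1) * T n h k (s + 1) ∈
        filtLT n (toLex (r + 1 + s, 0)) :=
      fun i j h k => filtLE_le_filtLT (by
        rw [toLex_add_toLex, Prod.Lex.toLex_lt_toLex]; left; simp)
        (mul_mem_filtLE (T_succ_mem_filtLE i j r) (T_succ_mem_filtLE h k s))
    have h4 : T n h j (s + 1) * T n i k (r + 1) ∈ filtLT n (toLex (r + 1 + s, 0)) :=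
      filtLE_le_filtLT (by
        rw [toLex_add_toLex, Prod.Lex.toLex_lt_toLex]; left; simp; lia)
        (mul_mem_filtLE (T_succ_mem_filtLE h j s) (T_succ_mem_filtLE i k r))
    exact add_mem (sub_mem (h3 _ _ _ _) h4) h2

/-- The main part of the commutator has full loop degree but a single factor, so it is smaller in
the second component of the weight. -/
theorem gen_mul_sub_mem (x y : Fin n × Fin n × ℕ) :
    gen x * gen y - gen y * gen x ∈ filtLT n (wt x + wt y) := by
  obtain ⟨i, j, r⟩ := x
  obtain ⟨h, k, s⟩ := y
  have h1 := lie_T_sub_mem i j h k r s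
  have h2 : ∀ i' j', T n i' j' (r + s + 1) ∈ filtLT n (wt (i, j, r) + wt (h, k, s)) := fun i' j' =>
    filtLE_le_filtLT (by
      rw [wt, wt, toLex_add_toLex, Prod.Lex.toLex_lt_toLex]; right; simp)
      (T_succ_mem_filtLE i' j' (r + s))
  rw [Ring.lie_def] at h1
  rw [gen, gen]
  refine (Submodule.sub_mem_iff_left _ ?_).mp (filtLT_mono ?_ h1)
  · have h3 : ∀ (p : Prop) [Decidable p] (i' j' : Fin n), (if p then T n i' j' (r + s + 1) else 0) ∈
        filtLT n (wt (i, j, r) + wt (h, k, s)) := fun p _ i' j' => by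
      split_ifs
      exacts [h2 _ _, zero_mem _]
    exact sub_mem (h3 _ _ _) (h3 _ _ _)
  · rw [wt, wt, toLex_add_toLex, Prod.Lex.toLex_le_toLex]; right; simp

theorem list_prod_sub_mem_of_perm {l l' : List (Fin n × Fin n × ℕ)} (h : l.Perm l') :
    (l.map gen).prod - (l'.map gen).prod ∈ filtLT n (l.map wt).sum := by
  induction h with
  | nil => simp
  | cons x h ih =>
    simp only [List.map_cons, List.prod_cons, List.sum_cons, ← mul_sub]
    exact mul_mem_filtLT_right (gen_mem_filtLE x) ih
  | swap x y l =>
    simp only [List.map_cons, List.prod_cons, List.sum_cons, ← mul_assoc, ← sub_mul, ← add_assoc]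
    exact mul_mem_filtLT_left (gen_mul_sub_mem y x) (list_prod_mem_filtLE l)
  | trans h1 h2 ih1 ih2 =>
    rw [← (h1.map wt).sum_eq] at ih2
    simpa using add_mem ih1 ih2

end Yangian

/-! ### Leading terms in the commutative polynomial ring. -/

namespace Yangian

variable {n : ℕ} {v w : ℕ ×ₗ ℕ} {x y : Yangian n}

local notation "Idx" => Fin n × Fin n × ℕ

variable (n) in
/-- Polynomials that are homogeneous of degree `w`. -/
noncomputable def homog (w : ℕ ×ₗ ℕ) : Submodule ℂ (MvPolynomial Idx ℂ) :=
  MvPolynomial.restrictSupport ℂ {m | Finsupp.weight wt m = w}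

/-- The element `x` of degree at most `w` has the leading term `p`, homogeneous of degree `w`. -/
def HasLead (w : ℕ ×ₗ ℕ) (x : Yangian n) (p : MvPolynomial Idx ℂ) : Prop :=
  p ∈ homog n w ∧ x - orderedEval n p ∈ filtLT n w

theorem monomial_mem_homog (m : Idx →₀ ℕ) (c : ℂ) :
    MvPolynomial.monomial m c ∈ homog n (Finsupp.weight wt m) := by
  rw [homog, MvPolynomial.monomial_mem_restrictSupport]
  exact Or.inl rfl

theorem mul_mem_homog {p q : MvPolynomial Idx ℂ} (hp : p ∈ homog n v) (hq : q ∈ homog n w) :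
    p * q ∈ homog n (v + w) := by
  have h := Submodule.mul_mem_mul hp hq
  rw [homog, homog, ← MvPolynomial.restrictSupport_add] at h
  refine MvPolynomial.restrictSupport_mono _ ?_ h
  rintro _ ⟨a, ha, b, hb, rfl⟩
  simp only [Set.mem_ofPred_eq, map_add] at ha hb ⊢
  rw [ha, hb]

theorem orderedEval_mem_filtLE {p : MvPolynomial Idx ℂ} (hp : p ∈ homog n w) :
    orderedEval n p ∈ filtLE n w := by
  rw [homog, MvPolynomial.restrictSupport_eq_span] at hp
  induction hp using Submodule.span_induction with
  | mem x hx =>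
    obtain ⟨m, rfl, rfl⟩ := hx
    rw [orderedEval_monomial, one_smul, ← list_sum_map_toList_toMultiset]
    exact list_prod_mem_filtLE _
  | zero => simp
  | add x y _ _ hx hy => rw [map_add]; exact add_mem hx hy
  | smul c x _ hx => rw [map_smul]; exact Submodule.smul_mem _ _ hx

theorem HasLead.mem_filtLE {p : MvPolynomial Idx ℂ} (h : HasLead w x p) : x ∈ filtLE n w := by
  rw [← sub_add_cancel x (orderedEval n p)]
  exact add_mem (filtLT_le_filtLE h.2) (orderedEval_mem_filtLE h.1)

theorem HasLead.add {p q : MvPolynomial Idx ℂ} (hx : HasLead w x p) (hy : HasLead w y q) :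
    HasLead w (x + y) (p + q) := by
  refine ⟨add_mem hx.1 hy.1, ?_⟩
  rw [map_add, add_sub_add_comm]
  exact add_mem hx.2 hy.2

theorem smul_sub_eq (c : ℂ) (x y : Yangian n) : c • x - c • y = c • (x - y) :=
  (smul_sub c x y).symm

theorem HasLead.smul {p : MvPolynomial Idx ℂ} (c : ℂ) (hx : HasLead w x p) :
    HasLead w (c • x) (c • p) := by
  refine ⟨Submodule.smul_mem _ _ hx.1, ?_⟩
  rw [map_smul, smul_sub_eq]
  exact Submodule.smul_mem _ _ hx.2

theorem hasLead_zero_iff : HasLead w x 0 ↔ x ∈ filtLT n w := by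
  rw [HasLead, map_zero, sub_zero, and_iff_right (zero_mem _)]

theorem HasLead.sub {p q : MvPolynomial Idx ℂ} (hx : HasLead w x p) (hy : HasLead w y q) :
    HasLead w (x - y) (p - q) := by
  refine ⟨sub_mem hx.1 hy.1, ?_⟩
  rw [map_sub, sub_sub_sub_comm]
  exact sub_mem hx.2 hy.2

theorem HasLead.add_filtLT {p : MvPolynomial Idx ℂ} (hx : HasLead w x p) (hy : y ∈ filtLT n w) :
    HasLead w (x + y) p := by
  simpa using hx.add (hasLead_zero_iff.mpr hy)

theorem HasLead.sum {ι : Type*} (t : Finset ι) {x : ι → Yangian n} {p : ι → MvPolynomial Idx ℂ}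
    (h : ∀ i ∈ t, HasLead w (x i) (p i)) : HasLead w (∑ i ∈ t, x i) (∑ i ∈ t, p i) := by
  classical
  induction t using Finset.induction_on with
  | empty => exact hasLead_zero_iff.mpr (zero_mem _)
  | insert i t hi ih =>
    rw [Finset.sum_insert hi, Finset.sum_insert hi]
    exact (h i (Finset.mem_insert_self i t)).add
      (ih fun j hj => h j (Finset.mem_insert_of_mem hj))

theorem list_prod_X_eq (l : List Idx) :
    (l.map MvPolynomial.X).prod =
      (MvPolynomial.monomial (Multiset.toFinsupp (l : Multiset Idx)) 1 : MvPolynomial Idx ℂ) := by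
  induction l with
  | nil => simp
  | cons x l ih =>
    rw [List.map_cons, List.prod_cons, ih, MvPolynomial.X, MvPolynomial.monomial_mul, one_mul,
      ← Multiset.cons_coe, ← Multiset.singleton_add, map_add, Multiset.toFinsupp_singleton]

theorem hasLead_list_prod (l : List Idx) :
    HasLead (l.map wt).sum (l.map gen).prod (l.map MvPolynomial.X).prod := by
  classical
  have h1 : l.Perm (Multiset.toFinsupp (l : Multiset Idx)).toMultiset.toList := by
    rw [← Multiset.coe_eq_coe, Multiset.coe_toList, Multiset.toFinsupp_toMultiset]
  have h2 := list_prod_sub_mem_of_perm h1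
  rw [list_prod_X_eq]
  refine ⟨?_, by rwa [orderedEval_monomial, one_smul]⟩
  rw [(h1.map wt).sum_eq, list_sum_map_toList_toMultiset]
  exact monomial_mem_homog _ _

theorem hasLead_gen (x : Idx) : HasLead (wt x) (gen x) (MvPolynomial.X x) := by
  simpa using hasLead_list_prod [x]

/-- A linear statement about homogeneous polynomials holds if it holds for products of variables. -/
theorem homog_induction {P : MvPolynomial Idx ℂ → Prop}
    (hl : ∀ l : List Idx, (l.map wt).sum = w → P (l.map MvPolynomial.X).prod)
    (h0 : P 0) (hadd : ∀ p q, P p → P q → P (p + q)) (hsmul : ∀ (c : ℂ) p, P p → P (c • p))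
    {p : MvPolynomial Idx ℂ} (hp : p ∈ homog n w) : P p := by
  classical
  rw [homog, MvPolynomial.restrictSupport_eq_span] at hp
  induction hp using Submodule.span_induction with
  | mem x hx =>
    obtain ⟨m, rfl, rfl⟩ := hx
    have := hl m.toMultiset.toList (list_sum_map_toList_toMultiset _ _)
    rwa [list_prod_X_eq, Multiset.coe_toList, Finsupp.toMultiset_toFinsupp] at this
  | zero => exact h0
  | add x y _ _ hx hy => exact hadd _ _ hx hy
  | smul c x _ hx => exact hsmul _ _ hx

theorem orderedEval_mul_sub_mem {p q : MvPolynomial Idx ℂ} (hp : p ∈ homog n v)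
    (hq : q ∈ homog n w) :
    orderedEval n p * orderedEval n q - orderedEval n (p * q) ∈ filtLT n (v + w) := by
  have key : ∀ l : List Idx, (l.map wt).sum = v → ∀ l' : List Idx, (l'.map wt).sum = w →
      orderedEval n (l.map MvPolynomial.X).prod * orderedEval n (l'.map MvPolynomial.X).prod -
        orderedEval n ((l.map MvPolynomial.X).prod * (l'.map MvPolynomial.X).prod) ∈
        filtLT n (v + w) := by
    rintro l rfl l' rfl
    have h1 := hasLead_list_prod l
    have h2 := hasLead_list_prod l'
    have h3 := (hasLead_list_prod (l ++ l')).2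
    simp only [List.map_append, List.prod_append, List.sum_append] at h3
    have h4 := mul_mem_filtLT_left h1.2 h2.mem_filtLE
    have h5 := mul_mem_filtLT_right (orderedEval_mem_filtLE h1.1) h2.2
    convert sub_mem h3 (add_mem h4 h5) using 1
    simp only [mul_sub, sub_mul]
    abel
  refine homog_induction (P := fun p => orderedEval n p * orderedEval n q -
    orderedEval n (p * q) ∈ filtLT n (v + w)) (fun l hl => ?_) (by simp) (fun p p' hp hp' => ?_)
    (fun c p hp => ?_) hp
  · refine homog_induction (P := fun q => orderedEval n (l.map MvPolynomial.X).prod *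
      orderedEval n q - orderedEval n ((l.map MvPolynomial.X).prod * q) ∈ filtLT n (v + w))
      (key l hl) (by simp) (fun p p' hp hp' => ?_) (fun c p hp => ?_) hq
    · simp only [map_add, mul_add, add_sub_add_comm]
      exact add_mem hp hp'
    · simp only [map_smul, mul_smul_comm, smul_sub_eq]
      exact Submodule.smul_mem _ _ hp
  · simp only [map_add, add_mul, add_sub_add_comm]
    exact add_mem hp hp'
  · simp only [map_smul, smul_mul_assoc, smul_sub_eq]
    exact Submodule.smul_mem _ _ hp

theorem HasLead.mul {p q : MvPolynomial Idx ℂ} (hx : HasLead v x p) (hy : HasLead w y q) :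
    HasLead (v + w) (x * y) (p * q) := by
  refine ⟨mul_mem_homog hx.1 hy.1, ?_⟩
  have h4 := mul_mem_filtLT_left hx.2 hy.mem_filtLE
  have h5 := mul_mem_filtLT_right (orderedEval_mem_filtLE hx.1) hy.2
  convert add_mem (add_mem h4 h5) (orderedEval_mul_sub_mem hx.1 hy.1) using 1
  simp only [mul_sub, sub_mul]
  abel

theorem hasLead_one : HasLead 0 (1 : Yangian n) 1 := by
  simpa using hasLead_list_prod (n := n) []

theorem HasLead.list_prod {ι : Type*} {u : ι → ℕ ×ₗ ℕ} {x : ι → Yangian n}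
    {p : ι → MvPolynomial Idx ℂ} (l : List ι) (h : ∀ i ∈ l, HasLead (u i) (x i) (p i)) :
    HasLead (l.map u).sum (l.map x).prod (l.map p).prod := by
  induction l with
  | nil => exact hasLead_one
  | cons i l ih =>
    simpa using (h i List.mem_cons_self).mul (ih fun j hj => h j (List.mem_cons_of_mem _ hj))

/-- Replace a product by its ordered form; the error has smaller weight, and the lexicographic order
is well founded. -/
theorem filtLT_le_map (w : ℕ ×ₗ ℕ) : filtLT n w ≤
    (MvPolynomial.restrictSupport ℂ {m | Finsupp.weight wt m < w}).map (orderedEval n) := by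
  induction w using WellFoundedLT.induction with
  | _ w ih =>
    refine Submodule.span_le.mpr ?_
    rintro _ ⟨l, hl, rfl⟩
    have h := hasLead_list_prod l
    rw [← sub_add_cancel (l.map gen).prod (orderedEval n (l.map MvPolynomial.X).prod)]
    refine add_mem (Submodule.map_mono (MvPolynomial.restrictSupport_mono _ ?_) (ih _ hl h.2))
      (Submodule.mem_map_of_mem (MvPolynomial.restrictSupport_mono _ ?_ h.1))
    · exact fun m (hm : _ < _) => hm.trans hl
    · exact fun m (hm : _ = _) => hm.trans_lt hl

/-- Leading terms are unique. -/
theorem HasLead.eq_zero {p : MvPolynomial Idx ℂ} (h : HasLead w x p) (hx : x ∈ filtLT n w) :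
    p = 0 := by
  have h1 : orderedEval n p ∈ filtLT n w := by
    rw [← sub_sub_cancel x (orderedEval n p)]
    exact sub_mem hx h.2
  obtain ⟨q, hq, hpq⟩ := filtLT_le_map w h1
  obtain rfl := orderedEval_injective hpq
  ext m
  by_contra hm
  rw [MvPolynomial.coeff_zero, ← ne_eq, ← MvPolynomial.mem_support_iff] at hm
  have h2 : Finsupp.weight wt m < w := hq hm
  have h3 : Finsupp.weight wt m = w := h.1 hm
  exact h2.ne h3

theorem exists_hasLead (hx : x ∈ filtLE n w) : ∃ p, HasLead w x p := by
  induction hx using Submodule.span_induction with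
  | mem x hx =>
    obtain ⟨l, hl, rfl⟩ := hx
    rcases hl.eq_or_lt with rfl | hl
    · exact ⟨_, hasLead_list_prod l⟩
    · exact ⟨0, hasLead_zero_iff.mpr (Submodule.subset_span ⟨l, hl, rfl⟩)⟩
  | zero => exact ⟨0, hasLead_zero_iff.mpr (zero_mem _)⟩
  | add x y _ _ hx hy =>
    obtain ⟨p, hp⟩ := hx
    obtain ⟨q, hq⟩ := hy
    exact ⟨_, hp.add hq⟩
  | smul c x _ hx =>
    obtain ⟨p, hp⟩ := hx
    exact ⟨_, hp.smul c⟩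

/-- Weights such as `(1, 0)` have no immediate predecessor, so a bound `v < w` has to be found for
each element; at the least weight only zero remains. -/
theorem eq_zero_or_mem_filtLE_of_mem_filtLT (hx : x ∈ filtLT n w) :
    x = 0 ∨ ∃ v < w, x ∈ filtLE n v := by
  induction hx using Submodule.span_induction with
  | mem x hx =>
    obtain ⟨l, hl, rfl⟩ := hx
    exact Or.inr ⟨_, hl, list_prod_mem_filtLE l⟩
  | zero => exact Or.inl rfl
  | add x y _ _ hx hy =>
    rcases hx with rfl | ⟨v, hv, hx⟩
    · simpa using hy
    rcases hy with rfl | ⟨v', hv', hy⟩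
    · exact Or.inr ⟨v, hv, by simpa using hx⟩
    · exact Or.inr ⟨max v v', max_lt hv hv', add_mem (filtLE_mono (le_max_left _ _) hx)
        (filtLE_mono (le_max_right _ _) hy)⟩
  | smul c x _ hx =>
    rcases hx with rfl | ⟨v, hv, hx⟩
    · simp
    · exact Or.inr ⟨v, hv, Submodule.smul_mem _ _ hx⟩

theorem exists_mem_filtLE (x : Yangian n) : ∃ w, x ∈ filtLE n w := by
  obtain ⟨x, rfl⟩ := RingQuot.mkAlgHom_surjective ℂ _ x
  induction x using FreeAlgebra.induction with
  | grade0 r =>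
    rw [AlgHom.commutes, Algebra.algebraMap_eq_smul_one]
    exact ⟨0, Submodule.smul_mem _ _ one_mem_filtLE⟩
  | grade1 x => exact ⟨_, gen_mem_filtLE x⟩
  | mul x y hx hy =>
    obtain ⟨v, hv⟩ := hx
    obtain ⟨w, hw⟩ := hy
    exact ⟨v + w, by rw [map_mul]; exact mul_mem_filtLE hv hw⟩
  | add x y hx hy =>
    obtain ⟨v, hv⟩ := hx
    obtain ⟨w, hw⟩ := hy
    exact ⟨max v w, by
      rw [map_add]
      exact add_mem (filtLE_mono (le_max_left _ _) hv) (filtLE_mono (le_max_right _ _) hw)⟩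

/-! ### Commutators with the diagonal generators. -/

/-- The derivation of polynomials that describes the leading terms of commutators with
`T_{i,i}^{(a + 1)}`. -/
noncomputable def shiftDer (i : Fin n) (a : ℕ) :
    Derivation ℂ (MvPolynomial Idx ℂ) (MvPolynomial Idx ℂ) :=
  MvPolynomial.mkDerivation ℂ fun x : Idx =>
    ((if x.1 = i then 1 else 0) - (if x.2.1 = i then 1 else 0) : ℂ) •
      MvPolynomial.X (x.1, x.2.1, x.2.2 + a)

theorem shiftDer_X (i : Fin n) (a : ℕ) (x : Idx) : shiftDer i a (MvPolynomial.X x) =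
    ((if x.1 = i then 1 else 0) - (if x.2.1 = i then 1 else 0) : ℂ) •
      MvPolynomial.X (x.1, x.2.1, x.2.2 + a) :=
  MvPolynomial.mkDerivation_X _ _ _

/-- The weight grows by `(a, 0)` rather than `(a, 1)`, since the bracket replaces two factors by
one. -/
theorem hasLead_lie_gen (i : Fin n) (a : ℕ) (x : Idx) :
    HasLead (wt x + toLex (a, 0)) (T n i i (a + 1) * gen x - gen x * T n i i (a + 1))
      (shiftDer i a (MvPolynomial.X x)) := by
  obtain ⟨h, k, s⟩ := x
  have h1 := lie_T_sub_mem i i h k a s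
  rw [shiftDer_X, wt, toLex_add_toLex]
  have h2 := (hasLead_gen (h, k, s + a)).smul
    ((if h = i then 1 else 0) - (if k = i then 1 else 0) : ℂ)
  rw [wt] at h2
  have h3 : (if h = i then T n i k (a + s + 1) else 0) -
      (if i = k then T n h i (a + s + 1) else 0) =
      ((if h = i then 1 else 0) - (if k = i then 1 else 0) : ℂ) • gen (h, k, s + a) := by
    rw [gen, add_comm s a]
    by_cases e1 : h = i <;> by_cases e2 : k = i
    · simp [e1, e2]
    · simp [e1, e2, Ne.symm e2]
    · subst e2
      rw [if_neg e1, if_pos rfl, if_neg e1, if_pos rfl, zero_sub, zero_sub]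
      exact (neg_one_smul ℂ _).symm
    · simp [e1, e2, Ne.symm e2]
  have h4 := h2.add_filtLT (filtLT_mono (n := n) (show toLex (a + s, 0) ≤ toLex (s + a, 1) by
    rw [Prod.Lex.toLex_le_toLex]; right; simp [add_comm]) h1)
  rwa [h3, add_sub_cancel, Ring.lie_def] at h4

theorem hasLead_lie_list_prod (i : Fin n) (a : ℕ) (l : List Idx) :
    HasLead ((l.map wt).sum + toLex (a, 0))
      (T n i i (a + 1) * (l.map gen).prod - (l.map gen).prod * T n i i (a + 1))
      (shiftDer i a (l.map MvPolynomial.X).prod) := by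
  induction l with
  | nil =>
    simp only [List.map_nil, List.prod_nil, mul_one, one_mul, sub_self, Derivation.map_one_eq_zero]
    exact hasLead_zero_iff.mpr (zero_mem _)
  | cons x l ih =>
    have h1 := (hasLead_lie_gen i a x).mul (hasLead_list_prod l)
    have h2 := (hasLead_gen x).mul ih
    rw [add_right_comm] at h1
    rw [← add_assoc] at h2
    simp only [List.map_cons, List.prod_cons, List.sum_cons, Derivation.leibniz, smul_eq_mul]
    convert h2.add h1 using 1
    · simp only [mul_sub, sub_mul, mul_assoc]
      abel
    · ring

theorem lie_mem_filtLT (i : Fin n) (a : ℕ) (hx : x ∈ filtLT n w) :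
    T n i i (a + 1) * x - x * T n i i (a + 1) ∈ filtLT n (w + toLex (a, 0)) := by
  induction hx using Submodule.span_induction with
  | mem x hx =>
    obtain ⟨l, hl, rfl⟩ := hx
    exact filtLE_le_filtLT (add_lt_add_left hl _) (hasLead_lie_list_prod i a l).mem_filtLE
  | zero => simp
  | add x y _ _ hx hy => rw [mul_add, add_mul, add_sub_add_comm]; exact add_mem hx hy
  | smul c x _ hx =>
    rw [mul_smul_comm, smul_mul_assoc, smul_sub_eq]; exact Submodule.smul_mem _ _ hx

theorem HasLead.lie_T {p : MvPolynomial Idx ℂ} (h : HasLead w x p) (i : Fin n) (a : ℕ) :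
    HasLead (w + toLex (a, 0)) (T n i i (a + 1) * x - x * T n i i (a + 1)) (shiftDer i a p) := by
  have key : HasLead (w + toLex (a, 0)) (T n i i (a + 1) * orderedEval n p -
      orderedEval n p * T n i i (a + 1)) (shiftDer i a p) := by
    refine homog_induction (P := fun p => HasLead (w + toLex (a, 0))
      (T n i i (a + 1) * orderedEval n p - orderedEval n p * T n i i (a + 1)) (shiftDer i a p))
      (fun l hl => ?_) ?_ (fun p q hp hq => ?_) (fun c p hp => ?_) h.1
    · have h1 := hasLead_lie_list_prod i a l
      have h2 := lie_mem_filtLT i a (hasLead_list_prod l).2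
      rw [hl] at h1 h2
      convert h1.sub (hasLead_zero_iff.mpr h2) using 1
      · simp only [mul_sub, sub_mul]; abel
      · rw [sub_zero]
    · simp only [map_zero, mul_zero, zero_mul, sub_self]
      exact hasLead_zero_iff.mpr (zero_mem _)
    · simp only [map_add, mul_add, add_mul, add_sub_add_comm]
      exact hp.add hq
    · simp only [map_smul, Derivation.map_smul, mul_smul_comm, smul_mul_assoc, smul_sub_eq]
      exact hp.smul c
  convert key.add_filtLT (lie_mem_filtLT i a h.2) using 1
  simp only [mul_sub, sub_mul]
  abel

/-- A polynomial killed by all the derivations `shiftDer i a` only involves diagonal variables. -/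
theorem diag_of_shiftDer_eq_zero {p : MvPolynomial Idx ℂ} (hp : ∀ i a, shiftDer i a p = 0)
    {m : Idx →₀ ℕ} (hm : m ∈ p.support) {x : Idx} (hx : x ∈ m.support) : x.1 = x.2.1 := by
  classical
  by_contra hne
  obtain ⟨h, k, s⟩ := x
  have hne' : k ≠ h := fun e => hne e.symm
  -- A shift by `N` moves every variable outside `p`, so the derivative of `p` with respect to the
  -- shifted variable is zero.
  set N := p.vars.sup (fun x => x.2.2) + 1 with hN
  -- For `h ≠ k` the derivation sends `x_{h,k}^{(s)}` to the shifted variable with coefficient `1`,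
  -- so this bracket recovers the plain partial derivative.
  have hlie : ⁅(MvPolynomial.pderiv (h, k, s + N) :
      Derivation ℂ (MvPolynomial Idx ℂ) (MvPolynomial Idx ℂ)), shiftDer h N⁆ =
      MvPolynomial.pderiv (h, k, s) := by
    refine MvPolynomial.derivation_ext fun y => ?_
    obtain ⟨h', k', s'⟩ := y
    rw [Derivation.commutator_apply, shiftDer_X, MvPolynomial.pderiv_X, MvPolynomial.pderiv_X,
      Derivation.map_smul, MvPolynomial.pderiv_X]
    have h0 : shiftDer h N
        (Pi.single (M := fun _ => MvPolynomial Idx ℂ) (h, k, s + N) 1 (h', k', s')) = 0 := by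
      rw [Pi.single_apply]; split_ifs <;> simp
    rw [h0, sub_zero]
    simp only [Pi.single_apply, Prod.mk.injEq, add_left_inj]
    by_cases e1 : h' = h <;> by_cases e2 : k' = k <;> by_cases e3 : s' = s <;>
      simp [e1, e2, e3, hne']
  have h1 : MvPolynomial.pderiv (h, k, s + N) p = 0 := by
    refine MvPolynomial.pderiv_eq_zero_of_notMem_vars fun hv => ?_
    have := Finset.le_sup (f := fun x : Idx => x.2.2) hv
    dsimp only at this
    lia
  have h2 : MvPolynomial.pderiv (h, k, s) p = 0 := by
    rw [← hlie, Derivation.commutator_apply, hp, h1, map_zero, map_zero, sub_zero]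
  have h3 := congrArg (MvPolynomial.coeff (m - Finsupp.single (h, k, s) 1)) h2
  rw [MvPolynomial.coeff_pderiv, MvPolynomial.coeff_zero, tsub_add_cancel_of_le
    (Finsupp.single_le_iff.mpr (Nat.one_le_iff_ne_zero.mpr (Finsupp.mem_support_iff.mp hx)))] at h3
  rcases mul_eq_zero.mp h3 with h3 | h3
  · exact MvPolynomial.mem_support_iff.mp hm h3
  · exact Nat.cast_add_one_ne_zero _ h3

/-! ### The Cartan subalgebra and its centralizer. -/

theorem isGaussFactorization_DSeries (n : ℕ) :
    ∃ F E, IsGaussFactorization (TMatrix n) F (DSeries n) E :=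
  ⟨_, _, (existsUnique_gauss n).choose_spec.1⟩

theorem commute_D (i j : Fin n) (r s : ℕ) : Commute (D n i r) (D n j s) := by
  obtain ⟨F, E, h⟩ := isGaussFactorization_DSeries n
  exact isRTT_TMatrix.commute_diag coeff_zero_TMatrix h i j r s

theorem isShiftedFiltration_filtLT :
    IsShiftedFiltration fun d => filtLT n (toLex (d, 0)) where
  zero := by
    rw [filtLT, Submodule.span_eq_bot]
    rintro _ ⟨l, hl, _⟩
    exact absurd hl (not_lt_of_ge bot_le)
  mono a b hab := filtLT_mono (by
    rw [Prod.Lex.toLex_le_toLex]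
    rcases hab.eq_or_lt with h | h
    · right; simp [h]
    · exact Or.inl h)
  one_mem := filtLE_le_filtLT (by
    rw [← toLex_zero, Prod.Lex.toLex_lt_toLex]; left; simp) one_mem_filtLE
  mul_mem := by
    intro a b x y hx hy
    have h := Submodule.mul_mem_mul hx hy
    rw [filtLT, filtLT, Submodule.span_mul_span] at h
    refine Submodule.span_mono ?_ h
    rintro _ ⟨_, ⟨l, hl, rfl⟩, _, ⟨l', hl', rfl⟩, rfl⟩
    refine ⟨l ++ l', ?_, by simp⟩
    rw [List.map_append, List.sum_append]
    rw [Prod.Lex.lt_iff] at hl hl' ⊢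
    simp only [ofLex_toLex, not_lt_zero, and_false, or_false] at hl hl' ⊢
    rw [ofLex_add, Prod.fst_add]
    lia

theorem D_succ_sub_T_mem (i : Fin n) (r : ℕ) :
    D n i (r + 1) - T n i i (r + 1) ∈ filtLT n (toLex (r, 0)) := by
  obtain ⟨F, E, h⟩ := isGaussFactorization_DSeries n
  have := isShiftedFiltration_filtLT.gauss_diag_sub_mem coeff_zero_TMatrix (fun i j r => ?_) h i
    (r + 1)
  · simpa [D, TMatrix] using this
  · rcases r with _ | r
    · rw [map_sub, coeff_zero_TMatrix]
      split_ifs <;> simp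
    · have : coeff (r + 1) (TMatrix n i j - if i = j then 1 else 0) = T n i j (r + 1) := by
        split_ifs <;> simp [TMatrix, coeff_one]
      rw [this]
      exact filtLE_le_filtLT (by rw [Prod.Lex.toLex_lt_toLex]; left; simp) (T_succ_mem_filtLE i j r)

theorem hasLead_D (i : Fin n) (r : ℕ) :
    HasLead (wt (i, i, r)) (D n i (r + 1)) (MvPolynomial.X (i, i, r)) := by
  have := (hasLead_gen (i, i, r)).add_filtLT (filtLT_mono (show toLex (r, 0) ≤ wt (i, i, r) by
    rw [wt, Prod.Lex.toLex_le_toLex]; right; simp) (D_succ_sub_T_mem i r))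
  rwa [gen, add_sub_cancel] at this

/-- The difference of `D_i^{(a+1)}` and `T_{i,i}^{(a+1)}` lies below weight `(a, 0)`, hence cannot
affect the leading term even though a bracket only has weight `w + (a, 0)`. -/
theorem HasLead.lie_D {p : MvPolynomial Idx ℂ} (h : HasLead w x p) (i : Fin n) (a : ℕ) :
    HasLead (w + toLex (a, 0)) (D n i (a + 1) * x - x * D n i (a + 1)) (shiftDer i a p) := by
  have h1 := mul_mem_filtLT_left (D_succ_sub_T_mem i a) h.mem_filtLE
  have h2 := mul_mem_filtLT_right h.mem_filtLE (D_succ_sub_T_mem i a)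
  rw [add_comm] at h1
  convert (h.lie_T i a).add_filtLT (sub_mem h1 h2) using 1
  simp only [mul_sub, sub_mul]
  abel

theorem D_mem_cartan (i : Fin n) (r : ℕ) : D n i r ∈ cartan n :=
  Algebra.subset_adjoin ⟨i, r, rfl⟩

/-- Substitute `D_i^{(r+1)}`, which has the leading term `x_{i,i}^{(r)}`, for each diagonal
variable. -/
theorem exists_mem_cartan_hasLead {p : MvPolynomial Idx ℂ} (hp : p ∈ homog n w)
    (hd : ∀ m ∈ p.support, ∀ x ∈ m.support, x.1 = x.2.1) : ∃ y ∈ cartan n, HasLead w y p := by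
  have key : ∀ m : Idx →₀ ℕ, m ∈ p.support →
      HasLead w (m.toMultiset.toList.map fun x => D n x.1 (x.2.2 + 1)).prod
        (MvPolynomial.monomial m 1) := by
    intro m hm
    have h1 := HasLead.list_prod m.toMultiset.toList (u := wt)
      (x := fun x => D n x.1 (x.2.2 + 1)) (p := MvPolynomial.X) (fun x hx => by
        have hx' : x ∈ m.support := by simpa using hx
        have := hasLead_D x.1 x.2.2
        rwa [show ((x.1, x.1, x.2.2) : Idx) = x by
          obtain ⟨i, j, r⟩ := x; have := hd m hm _ hx'; dsimp only at this; rw [this]] at this)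
    have hw : Finsupp.weight wt m = w := hp hm
    rwa [list_sum_map_toList_toMultiset, hw, list_prod_X_eq, Multiset.coe_toList,
      Finsupp.toMultiset_toFinsupp] at h1
  refine ⟨∑ m ∈ p.support, p.coeff m •
    (m.toMultiset.toList.map fun x => D n x.1 (x.2.2 + 1)).prod, ?_, ?_⟩
  · refine sum_mem fun m _ => Subalgebra.smul_mem _ (list_prod_mem fun y hy => ?_) _
    obtain ⟨x, _, rfl⟩ := List.mem_map.mp hy
    exact D_mem_cartan _ _
  · have := HasLead.sum p.support fun m hm => (key m hm).smul (p.coeff m)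
    simp only [MvPolynomial.smul_monomial, smul_eq_mul, mul_one] at this
    rwa [← MvPolynomial.as_sum] at this

theorem cartan_commute : ∀ x ∈ cartan n, ∀ y ∈ cartan n, x * y = y * x := by
  have := Algebra.isMulCommutative_adjoin ℂ (A := Yangian n) (s := {x | ∃ i r, x = D n i r}) (by
    rintro _ ⟨i, r, rfl⟩ _ ⟨j, s, rfl⟩
    exact commute_D i j r s)
  intro x hx y hy
  exact congrArg Subtype.val (this.is_comm.comm ⟨x, hx⟩ ⟨y, hy⟩)

/-- The leading term of `x` is diagonal, so some `y` in the Cartan subalgebra shares it; `x - y` has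
smaller weight and still commutes with every `D_i^{(r)}` because the Cartan subalgebra is
commutative. -/
theorem mem_cartan_of_commute_aux (w : ℕ ×ₗ ℕ) : ∀ x ∈ filtLE n w,
    (∀ i r, D n i r * x = x * D n i r) → x ∈ cartan n := by
  induction w using WellFoundedLT.induction with
  | _ w ih =>
    intro x hx hc
    obtain ⟨p, hp⟩ := exists_hasLead hx
    have hd : ∀ i a, shiftDer i a p = 0 := fun i a => by
      refine (hp.lie_D i a).eq_zero ?_
      rw [hc, sub_self]
      exact zero_mem _
    obtain ⟨y, hy, hyp⟩ := exists_mem_cartan_hasLead hp.1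
      fun m hm x hx => diag_of_shiftDer_eq_zero hd hm hx
    have hxy : x - y ∈ cartan n := by
      have h1 := hp.sub hyp
      rw [sub_self, hasLead_zero_iff] at h1
      rcases eq_zero_or_mem_filtLE_of_mem_filtLT h1 with h | ⟨v, hv, h⟩
      · rw [h]; exact zero_mem _
      · refine ih v hv _ h fun i r => ?_
        rw [mul_sub, sub_mul, hc, cartan_commute _ (D_mem_cartan i r) _ hy]
    simpa using add_mem hxy hy

/-- The Cartan subalgebra is its own centralizer. -/
theorem mem_cartan_of_commute (hc : ∀ i r, D n i r * x = x * D n i r) : x ∈ cartan n := by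
  obtain ⟨w, hw⟩ := exists_mem_filtLE x
  exact mem_cartan_of_commute_aux w x hw hc

end Yangian

theorem corollary7p5 (n : ℕ) :
    Maximal (fun S : Subalgebra ℂ (Yangian n) => ∀ x ∈ S, ∀ y ∈ S, x * y = y * x)
      (Yangian.cartan n) :=
  ⟨Yangian.cartan_commute, fun _ hS hle _ hx =>
    Yangian.mem_cartan_of_commute fun i r => hS _ (hle (Yangian.D_mem_cartan i r)) _ hx⟩
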